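/- Let $\omega = e^{i\pi/3}$. Starting from the oriented unit segment from $0$ to $1$ in $\mathbb{C}$, iteratively replace every oriented segment $\overrightarrow{AE}$ by the four segments $\overrightarrow{AB}, \overrightarrow{BC}, \overrightarrow{CD}, \overrightarrow{DE}$, where $B = A + \frac{E-A}{3}$, $D = A + \frac{2(E-A)}{3}$ and $C = D + \omega (E-D)$ (so that $DEC$ is an equilateral triangle, with $C$ to the left of $\overrightarrow{AE}$). Let $K_n$ be the set of endpoints of the segments present after $n$ iterations; the Kochawave curve is $K = \overline{\bigcup_{n \ge 0} K_n}$. Let the Kochawave region $R$ be the region enclosed by $K$ and its base segment $[0,1]$, that is, the union of $K \cup [0,1]$ and the bounded connected components of $\mathbb{C} \setminus (K \cup [0,1])$. Let $A$ be the area of $R$ and let $m \in \mathbb{C}$ be the centroid of $R$. Then the solid of revolution in $\mathbb{R}^3$ obtained by revolving $R$ about the line through its base segment (the real axis) has volume $$V = 2\pi \cdot \operatorname{Im}(m) \cdot A = \frac{17\pi}{444}.$$ -/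

import Mathlib

open MeasureTheory

noncomputable section

namespace Kochawave

/-- `ω = e^{iπ/3}`; multiplication by `ω` is the counterclockwise rotation by 60 degrees. -/
def omega : ℂ := Complex.exp (Complex.I * Real.pi / 3)

/-- The point `B` of the replacement of the oriented segment `AE` (one third of the way). -/
def pointB (A E : ℂ) : ℂ := A + (E - A) / 3

/-- The point `D` of the replacement of the oriented segment `AE` (two thirds of the way). -/
def pointD (A E : ℂ) : ℂ := A + 2 * (E - A) / 3

/-- The point `C` to the left of `AE` for which the triangle `DEC` is equilateral. -/
def pointC (A E : ℂ) : ℂ := pointD A E + omega * (E - pointD A E)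

/-- The four oriented segments `AB`, `BC`, `CD`, `DE` by which the oriented segment `AE`
is replaced. -/
def replacement (s : ℂ × ℂ) : Set (ℂ × ℂ) :=
  {(s.1, pointB s.1 s.2), (pointB s.1 s.2, pointC s.1 s.2),
   (pointC s.1 s.2, pointD s.1 s.2), (pointD s.1 s.2, s.2)}

/-- The oriented segments present after `n` iterations, starting from the unit segment
from `0` to `1`. -/
def segments : ℕ → Set (ℂ × ℂ)
  | 0 => {(0, 1)}
  | n + 1 => ⋃ s ∈ segments n, replacement s

/-- The set of endpoints of the segments present after `n` iterations. -/
def endpoints (n : ℕ) : Set ℂ := {z | ∃ s ∈ segments n, z = s.1 ∨ z = s.2}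

/-- The Kochawave curve: the closure of the limit (the union) of the increasing sequence of
sets of endpoints. -/
def curve : Set ℂ := closure (⋃ n, endpoints n)

/-- The set of points enclosed by a plane set `X`: `X` together with the bounded connected
components of its complement. -/
def enclosed (X : Set ℂ) : Set ℂ :=
  X ∪ {z | z ∉ X ∧ Bornology.IsBounded (connectedComponentIn Xᶜ z)}

/-- The Kochawave region: what the Kochawave curve and its base segment `[0, 1]` enclose. -/
def region : Set ℂ := enclosed (curve ∪ segment ℝ (0 : ℂ) 1)

/-- The area of a plane set. -/
def area (S : Set ℂ) : ℝ := volume.real S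

/-- The centroid (mean position with respect to area) of a plane set. -/
def centroid (S : Set ℂ) : ℂ := ⨍ z in S, z

/-- The set in space swept out when the plane set `S` is revolved about the real axis. The
plane is placed in space as the first two coordinates. -/
def revolve (S : Set ℂ) : Set (EuclideanSpace ℝ (Fin 3)) :=
  {p | ∃ z ∈ S, ∃ θ : ℝ, p = !₂[z.re, z.im * Real.cos θ, z.im * Real.sin θ]}

end Kochawave

end

noncomputable section

namespace Kochawave

open Topology Filter

/-! ### Coordinates with respect to the basis `1, ω` -/

/-! The region is identified with a self-similar set, `attractor`, made of the triangle `BDC` and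
four similar copies of itself. Coordinates `sc`, `uc` in the basis `1, ω` make every side condition
linear with rational coefficients.

Area: the four copies have area ratios summing to `2/3`, so subadditivity gives `|attractor| ≤ √3/36
+ (2/3)|attractor|`, an upper bound `√3/12`. Conversely the attractor and its two rotations by 120°
about the centre cover the equilateral triangle on the base (`equi_subset_tiles`), whose area is
`√3/4`. Both estimates are therefore equalities (`volume_real_attractor`), which forces the pieces,
and likewise the rotated copies, to overlap only in null sets (`aedisjoint_piece`,
`aedisjoint_rotPiece`). The first moment then satisfies a linear equation over `ℂ`, whose solution
has imaginary part `17/888` (`integral_attractor_im`).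

Topology: null overlaps become genuine disjointness away from the curve, because the sets involved
are closures of their interiors. Hence a point of the attractor off the curve and the base is
interior (`uc_eq_zero_or_mem_nhds`), so the attractor lies in the region. For the converse, the
complement of the attractor has no bounded component: a point in a rotated copy travels inside that
copy to its base, a side of the equilateral triangle, and escapes
(`not_isBounded_connectedComponentIn`). The volume formula is Pappus' theorem, proved by polar
coordinates (`volume_revolve`). -/

theorem omega_re : omega.re = 1 / 2 := by
  have : Complex.I * Real.pi / 3 = ((Real.pi / 3 : ℝ) : ℂ) * Complex.I := by push_cast; ring
  rw [omega, this, Complex.exp_ofReal_mul_I_re, Real.cos_pi_div_three]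

theorem omega_im : omega.im = √3 / 2 := by
  have : Complex.I * Real.pi / 3 = ((Real.pi / 3 : ℝ) : ℂ) * Complex.I := by push_cast; ring
  rw [omega, this, Complex.exp_ofReal_mul_I_im, Real.sin_pi_div_three]

/-- The coefficient of `1` in the expansion of a complex number in the basis `1, ω`. -/
def sc (z : ℂ) : ℝ := z.re - z.im / √3

/-- The coefficient of `ω` in the expansion of a complex number in the basis `1, ω`. -/
def uc (z : ℂ) : ℝ := 2 * z.im / √3

theorem sqrt_three_sq : √3 * √3 = 3 := Real.mul_self_sqrt (by norm_num)

theorem im_eq (z : ℂ) : z.im = √3 / 2 * uc z := by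
  have : √3 ≠ 0 := by positivity
  rw [uc]; field_simp

theorem re_eq (z : ℂ) : z.re = sc z + uc z / 2 := by
  rw [sc, uc]; ring

theorem ext_coords {z w : ℂ} (hs : sc z = sc w) (hu : uc z = uc w) : z = w := by
  apply Complex.ext
  · rw [re_eq, re_eq, hs, hu]
  · rw [im_eq, im_eq, hu]

@[fun_prop] theorem continuous_sc : Continuous sc := by unfold sc; fun_prop

@[fun_prop] theorem continuous_uc : Continuous uc := by unfold uc; fun_prop

@[simp] theorem sc_add (z w : ℂ) : sc (z + w) = sc z + sc w := by simp [sc]; ring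
@[simp] theorem uc_add (z w : ℂ) : uc (z + w) = uc z + uc w := by simp [uc]; ring
@[simp] theorem sc_sub (z w : ℂ) : sc (z - w) = sc z - sc w := by simp [sc]; ring
@[simp] theorem uc_sub (z w : ℂ) : uc (z - w) = uc z - uc w := by simp [uc]; ring
@[simp] theorem sc_neg (z : ℂ) : sc (-z) = -sc z := by simp [sc]; ring
@[simp] theorem uc_neg (z : ℂ) : uc (-z) = -uc z := by simp [uc]; ring
@[simp] theorem sc_zero : sc 0 = 0 := by simp [sc]
@[simp] theorem uc_zero : uc 0 = 0 := by simp [uc]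
@[simp] theorem sc_one : sc 1 = 1 := by simp [sc]
@[simp] theorem uc_one : uc 1 = 0 := by simp [uc]
@[simp] theorem sc_ofReal (r : ℝ) : sc r = r := by simp [sc]
@[simp] theorem uc_ofReal (r : ℝ) : uc r = 0 := by simp [uc]
@[simp] theorem sc_ofNat (n : ℕ) [n.AtLeastTwo] : sc (ofNat(n)) = ofNat(n) := by
  simp [sc]
@[simp] theorem uc_ofNat (n : ℕ) [n.AtLeastTwo] : uc (ofNat(n)) = 0 := by simp [uc]
@[simp] theorem sc_omega : sc omega = 0 := by
  have : √3 ≠ 0 := by positivity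
  rw [sc, omega_re, omega_im]; field_simp; norm_num
@[simp] theorem uc_omega : uc omega = 1 := by
  have : √3 ≠ 0 := by positivity
  rw [uc, omega_im]; field_simp

@[simp] theorem sc_mul (z w : ℂ) : sc (z * w) = sc z * sc w - uc z * uc w := by
  have h := sqrt_three_sq
  have h0 : sc (z * w) = z.re * w.re - z.im * w.im - (z.re * w.im + z.im * w.re) / √3 := by
    simp [sc]
  rw [h0, im_eq z, im_eq w, re_eq z, re_eq w]
  field_simp
  linear_combination (-uc z * uc w) * h

@[simp] theorem uc_mul (z w : ℂ) :
    uc (z * w) = sc z * uc w + uc z * sc w + uc z * uc w := by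
  have h0 : uc (z * w) = 2 * (z.re * w.im + z.im * w.re) / √3 := by
    simp [uc]
  rw [h0, im_eq z, im_eq w, re_eq z, re_eq w]
  field_simp
  ring

@[simp] theorem sc_div_ofNat (z : ℂ) (n : ℕ) [n.AtLeastTwo] :
    sc (z / ofNat(n)) = sc z / ofNat(n) := by
  simp [sc, Complex.div_ofNat_re, Complex.div_ofNat_im]; ring

@[simp] theorem uc_div_ofNat (z : ℂ) (n : ℕ) [n.AtLeastTwo] :
    uc (z / ofNat(n)) = uc z / ofNat(n) := by
  simp [uc, Complex.div_ofNat_im]; ring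

@[simp] theorem sc_inv_ofNat (n : ℕ) [n.AtLeastTwo] :
    sc (ofNat(n) : ℂ)⁻¹ = (ofNat(n) : ℝ)⁻¹ := by
  rw [← one_div, sc_div_ofNat, sc_one, one_div]

@[simp] theorem uc_inv_ofNat (n : ℕ) [n.AtLeastTwo] : uc (ofNat(n) : ℂ)⁻¹ = 0 := by
  rw [← one_div, uc_div_ofNat, uc_one, zero_div]

theorem normSq_eq_coords (z : ℂ) :
    Complex.normSq z = sc z ^ 2 + sc z * uc z + uc z ^ 2 := by
  rw [Complex.normSq_apply, re_eq, im_eq]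
  linear_combination (uc z ^ 2 / 4) * sqrt_three_sq

theorem omega_sq : omega ^ 2 = omega - 1 := by
  rw [sq]; apply ext_coords <;> simp

/-! ### The iterated function system of the curve -/

/-- The linear coefficients of the four similarities of the curve. -/
def coef : Fin 4 → ℂ := ![1 / 3, (1 + omega) / 3, -omega / 3, 1 / 3]

/-- The images of the origin under the four similarities of the curve. -/
def orig : Fin 4 → ℂ := ![0, 1 / 3, 2 / 3 + omega / 3, 2 / 3]

/-- The similarity that maps `0` to `p` and has linear coefficient `c`. -/
def sim (p c z : ℂ) : ℂ := p + c * z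

/-- The four similarities that map `AE` to `AB`, `BC`, `CD`, `DE`. -/
def ifs (i : Fin 4) : ℂ → ℂ := sim (orig i) (coef i)

/-- The rotation by 120 degrees about the centre of the equilateral triangle on `[0, 1]`. -/
def rot : ℂ → ℂ := sim 1 (omega ^ 2)

@[simp] theorem sc_ifs0 (z : ℂ) : sc (ifs 0 z) = sc z / 3 := by
  simp [ifs, sim, orig, coef]; ring
@[simp] theorem uc_ifs0 (z : ℂ) : uc (ifs 0 z) = uc z / 3 := by
  simp [ifs, sim, orig, coef]; ring
@[simp] theorem sc_ifs1 (z : ℂ) : sc (ifs 1 z) = (1 + sc z - uc z) / 3 := by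
  simp [ifs, sim, orig, coef]; ring
@[simp] theorem uc_ifs1 (z : ℂ) : uc (ifs 1 z) = (sc z + 2 * uc z) / 3 := by
  simp [ifs, sim, orig, coef]; ring
@[simp] theorem sc_ifs2 (z : ℂ) : sc (ifs 2 z) = (2 + uc z) / 3 := by
  simp [ifs, sim, orig, coef]; ring
@[simp] theorem uc_ifs2 (z : ℂ) : uc (ifs 2 z) = (1 - sc z - uc z) / 3 := by
  simp [ifs, sim, orig, coef]; ring
@[simp] theorem sc_ifs3 (z : ℂ) : sc (ifs 3 z) = (2 + sc z) / 3 := by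
  simp [ifs, sim, orig, coef]; ring
@[simp] theorem uc_ifs3 (z : ℂ) : uc (ifs 3 z) = uc z / 3 := by
  simp [ifs, sim, orig, coef]; ring
@[simp] theorem sc_rot (z : ℂ) : sc (rot z) = 1 - sc z - uc z := by
  simp [rot, sim, omega_sq]; ring
@[simp] theorem uc_rot (z : ℂ) : uc (rot z) = sc z := by
  simp [rot, sim, omega_sq]

theorem normSq_coef (i : Fin 4) : Complex.normSq (coef i) = ![1 / 9, 1 / 3, 1 / 9, 1 / 9] i := by
  fin_cases i <;> simp [normSq_eq_coords, coef, -map_div₀, -map_neg] <;> norm_num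

theorem coef_ne_zero (i : Fin 4) : coef i ≠ 0 := by
  rw [← Complex.normSq_pos, normSq_coef]
  fin_cases i <;> simp

theorem normSq_omega : Complex.normSq omega = 1 := by
  simp [normSq_eq_coords]

theorem omega_sq_ne_zero : omega ^ 2 ≠ 0 := by
  apply pow_ne_zero
  rw [← Complex.normSq_pos, normSq_omega]
  exact one_pos

/-- The largest ratio is `1/√3`; `3/5` is a convenient rational upper bound, used as the common
contraction factor throughout. -/
theorem norm_coef_le (i : Fin 4) : ‖coef i‖ ≤ 3 / 5 := by
  apply abs_le_of_sq_le_sq' _ (by norm_num) |>.2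
  rw [← Complex.normSq_eq_norm_sq, normSq_coef]
  fin_cases i <;> norm_num

theorem continuous_sim (p c : ℂ) : Continuous (sim p c) := by unfold sim; fun_prop

@[fun_prop] theorem continuous_ifs (i : Fin 4) : Continuous (ifs i) := continuous_sim _ _

@[fun_prop] theorem continuous_rot : Continuous rot := continuous_sim _ _

/-- A similarity with nonzero coefficient as a homeomorphism. -/
def simHomeomorph (p c : ℂ) (hc : c ≠ 0) : ℂ ≃ₜ ℂ :=
  (Homeomorph.mulLeft₀ c hc).trans (Homeomorph.addLeft p)

theorem map_nhds_sim {p c : ℂ} (hc : c ≠ 0) (x : ℂ) : map (sim p c) (𝓝 x) = 𝓝 (sim p c x) :=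
  (simHomeomorph p c hc).map_nhds_eq x

theorem map_nhds_ifs (i : Fin 4) (x : ℂ) : map (ifs i) (𝓝 x) = 𝓝 (ifs i x) :=
  map_nhds_sim (coef_ne_zero i) x

theorem map_nhds_rot (x : ℂ) : map rot (𝓝 x) = 𝓝 (rot x) :=
  map_nhds_sim omega_sq_ne_zero x

theorem injective_sim {p c : ℂ} (hc : c ≠ 0) : Function.Injective (sim p c) :=
  (simHomeomorph p c hc).injective

theorem injective_ifs (i : Fin 4) : Function.Injective (ifs i) := injective_sim (coef_ne_zero i)

theorem image_closure_ifs (i : Fin 4) (S : Set ℂ) : ifs i '' closure S = closure (ifs i '' S) :=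
  (simHomeomorph _ _ (coef_ne_zero i)).image_closure S

theorem dist_ifs_le (i : Fin 4) (x y : ℂ) : dist (ifs i x) (ifs i y) ≤ 3 / 5 * dist x y := by
  simp only [ifs, sim, dist_eq_norm, add_sub_add_left_eq_sub, ← mul_sub, norm_mul]
  gcongr
  exact norm_coef_le i

theorem dist_rot (x y : ℂ) : dist (rot x) (rot y) = dist x y := by
  have h : ‖omega‖ = 1 := by
    have := normSq_omega
    rw [Complex.normSq_eq_norm_sq] at this
    nlinarith [norm_nonneg omega]
  simp only [rot, sim, dist_eq_norm, add_sub_add_left_eq_sub, ← mul_sub, norm_mul, norm_pow, h]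
  simp

theorem rot_rot_rot (z : ℂ) : rot (rot (rot z)) = z := by
  apply ext_coords <;> simp <;> ring

/-- This relation and the next two show that the tiling by three rotated attractors is inherited by
the corner triangle at `1` (the image of `equi` under `ifs 3`) and by the central triangle, since
`ifs 1` fixes the centre of rotation. -/
theorem ifs3_rot (z : ℂ) : ifs 3 (rot z) = rot (ifs 0 z) := by
  apply ext_coords <;> simp <;> ring

theorem ifs3_rot_rot (z : ℂ) : ifs 3 (rot (rot z)) = ifs 2 z := by
  apply ext_coords <;> simp <;> ring

theorem ifs1_rot (z : ℂ) : ifs 1 (rot z) = rot (ifs 1 z) := by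
  apply ext_coords <;> simp <;> ring

/-- A set whose points are obtained from its own points by contractions under which the
nonempty set `S` is stable lies in the closure of `S`. -/
theorem subset_closure_of_contraction {P S : Set ℂ} (hP : Bornology.IsBounded P)
    (hS : S.Nonempty)
    (h : ∀ x ∈ P, x ∈ S ∨ ∃ y ∈ P, ∃ g : ℂ → ℂ, (∀ a b, dist (g a) (g b) ≤ 3 / 5 * dist a b) ∧
      (∀ a ∈ S, g a ∈ S) ∧ g y = x) : P ⊆ closure S := by
  obtain ⟨k, hk⟩ := hS
  obtain ⟨C, hC⟩ := hP.subset_closedBall k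
  have key : ∀ n : ℕ, ∀ x ∈ P, ∃ a ∈ S, dist x a ≤ (3 / 5) ^ n * |C| := by
    intro n
    induction n with
    | zero =>
      intro x hx
      refine ⟨k, hk, ?_⟩
      have := Metric.mem_closedBall.1 (hC hx)
      simpa using this.trans (le_abs_self C)
    | succ n ih =>
      intro x hx
      rcases h x hx with hx | ⟨y, hy, g, hg, hgS, rfl⟩
      · exact ⟨x, hx, by rw [dist_self]; positivity⟩
      · obtain ⟨a, ha, hya⟩ := ih y hy
        refine ⟨g a, hgS a ha, (hg y a).trans ?_⟩
        rw [pow_succ]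
        linarith
  intro x hx
  rw [Metric.mem_closure_iff]
  intro ε hε
  have ht : Tendsto (fun n : ℕ => (3 / 5 : ℝ) ^ n * |C|) atTop (𝓝 0) := by
    simpa using (tendsto_pow_atTop_nhds_zero_of_lt_one (by norm_num : (0 : ℝ) ≤ 3 / 5)
      (by norm_num)).mul_const |C|
  obtain ⟨n, hn⟩ := (ht.eventually (gt_mem_nhds hε)).exists
  obtain ⟨a, ha, hxa⟩ := key n x hx
  exact ⟨a, ha, hxa.trans_lt hn⟩

/-! ### The attractor bounded by the curve and its base -/

/-- The closed triangle `BDC` of the replacement of the unit segment. -/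
def tri : Set ℂ := {z | 0 ≤ uc z ∧ sc z ≤ 2 / 3 ∧ 1 / 3 + uc z ≤ sc z}

/-- The closed equilateral triangle on the unit segment. -/
def equi : Set ℂ := {z | 0 ≤ sc z ∧ 0 ≤ uc z ∧ sc z + uc z ≤ 1}

/-- The union of all triangles that are added in the construction. -/
inductive Cell : ℂ → Prop
  | tri {x : ℂ} (hx : x ∈ tri) : Cell x
  | step (i : Fin 4) {x : ℂ} (hx : Cell x) : Cell (ifs i x)

/-- The attractor: the closure of the union of all triangles of the construction. -/
def attractor : Set ℂ := closure {x | Cell x}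

theorem isClosed_tri : IsClosed tri := by
  have h1 : IsClosed {z | 0 ≤ uc z} := isClosed_le (by fun_prop) (by fun_prop)
  have h2 : IsClosed {z | sc z ≤ 2 / 3} := isClosed_le (by fun_prop) (by fun_prop)
  have h3 : IsClosed {z | 1 / 3 + uc z ≤ sc z} := isClosed_le (by fun_prop) (by fun_prop)
  exact h1.inter (h2.inter h3)

theorem isClosed_equi : IsClosed equi := by
  have h1 : IsClosed {z | 0 ≤ sc z} := isClosed_le (by fun_prop) (by fun_prop)
  have h2 : IsClosed {z | 0 ≤ uc z} := isClosed_le (by fun_prop) (by fun_prop)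
  have h3 : IsClosed {z | sc z + uc z ≤ 1} := isClosed_le (by fun_prop) (by fun_prop)
  exact h1.inter (h2.inter h3)

theorem equi_subset_closedBall : equi ⊆ Metric.closedBall 0 1 := by
  rintro z ⟨h1, h2, h3⟩
  rw [mem_closedBall_zero_iff]
  apply abs_le_of_sq_le_sq' _ zero_le_one |>.2
  rw [← Complex.normSq_eq_norm_sq, normSq_eq_coords]
  nlinarith

theorem isBounded_equi : Bornology.IsBounded equi :=
  Metric.isBounded_closedBall.subset equi_subset_closedBall

theorem isCompact_equi : IsCompact equi :=
  Metric.isCompact_of_isClosed_isBounded isClosed_equi isBounded_equi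

theorem tri_subset_equi : tri ⊆ equi := by
  rintro z ⟨h1, h2, h3⟩
  refine ⟨?_, ?_, ?_⟩ <;> linarith

theorem ifs_mem_equi (i : Fin 4) {z : ℂ} (hz : z ∈ equi) : ifs i z ∈ equi := by
  obtain ⟨h1, h2, h3⟩ := hz
  fin_cases i <;> refine ⟨?_, ?_, ?_⟩ <;> simp <;> linarith

theorem rot_mem_equi {z : ℂ} (hz : z ∈ equi) : rot z ∈ equi := by
  obtain ⟨h1, h2, h3⟩ := hz
  refine ⟨?_, ?_, ?_⟩ <;> simp <;> linarith

theorem attractor_subset_equi : attractor ⊆ equi := by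
  refine closure_minimal (fun x hx => ?_) isClosed_equi
  have hc : Cell x := hx
  clear hx
  induction hc with
  | tri hx => exact tri_subset_equi hx
  | step i _ ih => exact ifs_mem_equi i ih

theorem isClosed_attractor : IsClosed attractor := isClosed_closure

theorem isCompact_attractor : IsCompact attractor :=
  isCompact_equi.of_isClosed_subset isClosed_attractor attractor_subset_equi

theorem cell_subset_attractor : {x | Cell x} ⊆ attractor := subset_closure

theorem tri_subset_attractor : tri ⊆ attractor :=
  fun _ hx => cell_subset_attractor (Cell.tri hx)

theorem attractor_eq : attractor = tri ∪ ⋃ i, ifs i '' attractor := by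
  have h : {x | Cell x} = tri ∪ ⋃ i, ifs i '' {x | Cell x} := by
    ext x
    simp only [Set.mem_ofPred_eq, Set.mem_union, Set.mem_iUnion, Set.mem_image]
    constructor
    · rintro (hx | ⟨i, hx⟩)
      · exact Or.inl hx
      · exact Or.inr ⟨i, _, hx, rfl⟩
    · rintro (hx | ⟨i, y, hy, rfl⟩)
      · exact Cell.tri hx
      · exact Cell.step i hy
  conv_lhs => rw [attractor, h, closure_union, isClosed_tri.closure_eq,
    closure_iUnion_of_finite]
  simp only [← image_closure_ifs, attractor]

theorem ifs_mem_attractor (i : Fin 4) {x : ℂ} (hx : x ∈ attractor) : ifs i x ∈ attractor := by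
  rw [attractor_eq]
  exact Or.inr (Set.mem_iUnion.2 ⟨i, x, hx, rfl⟩)

theorem image_ifs_subset_attractor (i : Fin 4) : ifs i '' attractor ⊆ attractor := by
  rintro _ ⟨x, hx, rfl⟩
  exact ifs_mem_attractor i hx

theorem tri_mem_nhds {z : ℂ} (h1 : 0 < uc z) (h2 : sc z < 2 / 3) (h3 : 1 / 3 + uc z < sc z) :
    tri ∈ 𝓝 z := by
  have e1 := continuous_uc.continuousAt.eventually (lt_mem_nhds h1)
  have e2 := continuous_sc.continuousAt.eventually (gt_mem_nhds h2)
  have e3 : ∀ᶠ w in 𝓝 z, 1 / 3 + uc w < sc w :=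
    ContinuousAt.eventually_lt (by fun_prop) (by fun_prop) h3
  filter_upwards [e1, e2, e3] with w w1 w2 w3 using ⟨w1.le, w2.le, w3.le⟩

theorem tri_subset_closure_interior : tri ⊆ closure (interior tri) := by
  intro z ⟨h1, h2, h3⟩
  -- Any interior point of the triangle would do: by convexity, points slightly moved towards it are
  -- interior.
  set a : ℂ := 11 / 20 + omega / 20 with ha
  have ha1 : uc a = 1 / 20 := by simp [ha]
  have ha2 : sc a = 11 / 20 := by simp [ha]
  have ht : Tendsto (fun t : ℝ => z + t * (a - z)) (𝓝[>] 0) (𝓝 z) := by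
    have : Continuous fun t : ℝ => z + t * (a - z) := by fun_prop
    have h := this.tendsto 0
    simp only [Complex.ofReal_zero, zero_mul, add_zero] at h
    exact h.mono_left nhdsWithin_le_nhds
  refine mem_closure_of_tendsto ht ?_
  filter_upwards [Ioo_mem_nhdsGT (one_pos : (0 : ℝ) < 1)] with t ht
  obtain ⟨t0, t1⟩ := ht
  rw [mem_interior_iff_mem_nhds]
  apply tri_mem_nhds <;> simp only [sc_add, uc_add, sc_mul, uc_mul, sc_sub, uc_sub, sc_ofReal,
    uc_ofReal, ha1, ha2] <;> nlinarith

/-- Each triangle of the construction is the closure of its interior. This is what later lets a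
measure-zero overlap exclude a common point. -/
theorem attractor_subset_closure_interior : attractor ⊆ closure (interior attractor) := by
  refine closure_minimal (fun x hx => ?_) isClosed_closure
  have hc : Cell x := hx
  clear hx
  induction hc with
  | tri hx =>
    exact closure_mono (interior_mono tri_subset_attractor) (tri_subset_closure_interior hx)
  | @step i x hx ih =>
    have h1 : ifs i x ∈ ifs i '' closure (interior attractor) := ⟨x, ih, rfl⟩
    rw [image_closure_ifs] at h1
    refine closure_mono ?_ h1
    refine interior_maximal ((Set.image_mono interior_subset).trans
      (image_ifs_subset_attractor i)) ?_
    exact (simHomeomorph _ _ (coef_ne_zero i)).isOpenMap _ isOpen_interior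

theorem ifs_attractor_subset_closure_interior (i : Fin 4) :
    ifs i '' attractor ⊆ closure (interior (ifs i '' attractor)) := by
  have h : ifs i '' interior attractor ⊆ interior (ifs i '' attractor) :=
    interior_maximal (Set.image_mono interior_subset)
      ((simHomeomorph _ _ (coef_ne_zero i)).isOpenMap _ isOpen_interior)
  calc ifs i '' attractor ⊆ ifs i '' closure (interior attractor) :=
        Set.image_mono attractor_subset_closure_interior
    _ = closure (ifs i '' interior attractor) := image_closure_ifs i _
    _ ⊆ _ := closure_mono h

/-- The middle third of the base is a side of `tri`, and `ifs 0`, `ifs 3` map the base onto the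
outer thirds. -/
theorem base_subset_attractor {x : ℂ} (hx : x ∈ equi) (hu : uc x = 0) : x ∈ attractor := by
  have h : {x | x ∈ equi ∧ uc x = 0} ⊆ closure attractor := by
    apply subset_closure_of_contraction (isBounded_equi.subset fun x hx => hx.1)
    · refine ⟨1 / 2, tri_subset_attractor ?_⟩
      norm_num [tri]
    · rintro x ⟨⟨h1, h2, h3⟩, hu⟩
      by_cases ha : sc x < 1 / 3
      · refine Or.inr ⟨3 * x, ⟨⟨?_, ?_, ?_⟩, ?_⟩, ifs 0, dist_ifs_le 0,
          fun a => ifs_mem_attractor 0, ?_⟩ <;> (try simp [hu]) <;> try linarith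
        apply ext_coords <;> simp
      · by_cases hb : sc x ≤ 2 / 3
        · exact Or.inl (tri_subset_attractor ⟨h2, hb, by linarith⟩)
        · refine Or.inr ⟨3 * x - 2, ⟨⟨?_, ?_, ?_⟩, ?_⟩, ifs 3, dist_ifs_le 3,
            fun a => ifs_mem_attractor 3, ?_⟩ <;> (try simp [hu]) <;> try linarith
          apply ext_coords <;> simp
  have := h ⟨hx, hu⟩
  rwa [isClosed_attractor.closure_eq] at this

/-! ### Self-similarity of the curve -/

/-- The image of an oriented segment under a map. -/
def segMap (f : ℂ → ℂ) (s : ℂ × ℂ) : ℂ × ℂ := (f s.1, f s.2)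

theorem replacement_segMap (i : Fin 4) (s : ℂ × ℂ) :
    replacement (segMap (ifs i) s) = segMap (ifs i) '' replacement s := by
  have hB : pointB (ifs i s.1) (ifs i s.2) = ifs i (pointB s.1 s.2) := by
    simp only [pointB, ifs, sim]; ring
  have hD : pointD (ifs i s.1) (ifs i s.2) = ifs i (pointD s.1 s.2) := by
    simp only [pointD, ifs, sim]; ring
  have hC : pointC (ifs i s.1) (ifs i s.2) = ifs i (pointC s.1 s.2) := by
    rw [pointC, hD]; simp only [pointC, pointD, ifs, sim]; ring
  simp only [replacement, segMap, hB, hC, hD, Set.image_insert_eq, Set.image_singleton]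

theorem segments_one : segments 1 = ⋃ i, segMap (ifs i) '' segments 0 := by
  have h0 : ifs 0 0 = 0 := by apply ext_coords <;> simp
  have h1 : ifs 0 1 = 1 / 3 := by apply ext_coords <;> simp
  have h2 : ifs 1 0 = 1 / 3 := by apply ext_coords <;> simp
  have h3 : ifs 1 1 = pointC 0 1 := by apply ext_coords <;> simp [pointC, pointD] <;> norm_num
  have h4 : ifs 2 0 = pointC 0 1 := by apply ext_coords <;> simp [pointC, pointD] <;> norm_num
  have h5 : ifs 2 1 = 2 / 3 := by apply ext_coords <;> simp
  have h6 : ifs 3 0 = 2 / 3 := by apply ext_coords <;> simp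
  have h7 : ifs 3 1 = 1 := by apply ext_coords <;> simp <;> norm_num
  ext s
  simp only [segments, Set.mem_singleton_iff, Set.iUnion_iUnion_eq_left, replacement, pointB,
    Set.image_singleton, segMap, Set.mem_iUnion, Fin.exists_fin_succ, h0, h1, h2, h3, h4, h5,
    Set.mem_insert_iff, pointD, sub_zero, zero_add, mul_one, Fin.succ_zero_eq_one,
    Fin.succ_one_eq_two]
  simp [show (Fin.succ (2 : Fin 3)) = (3 : Fin 4) from rfl, h6, h7]

theorem segments_succ_def (n : ℕ) : segments (n + 1) = ⋃ s ∈ segments n, replacement s := rfl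

theorem segments_succ (n : ℕ) : segments (n + 1) = ⋃ i, segMap (ifs i) '' segments n := by
  induction n with
  | zero => exact segments_one
  | succ n ih =>
    conv_lhs => rw [segments_succ_def, ih]
    ext s
    simp only [Set.mem_iUnion, exists_prop, Set.mem_image]
    constructor
    · rintro ⟨_, ⟨i, t, ht, rfl⟩, hs⟩
      rw [replacement_segMap] at hs
      obtain ⟨r, hr, rfl⟩ := hs
      exact ⟨i, r, by rw [segments_succ_def]; exact Set.mem_biUnion ht hr, rfl⟩
    · rintro ⟨i, r, hr, rfl⟩
      rw [segments_succ_def] at hr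
      obtain ⟨t, ht, hr⟩ := Set.mem_iUnion₂.1 hr
      refine ⟨_, ⟨i, t, ht, rfl⟩, ?_⟩
      rw [replacement_segMap]
      exact ⟨r, hr, rfl⟩

theorem endpoints_succ (n : ℕ) : endpoints (n + 1) = ⋃ i, ifs i '' endpoints n := by
  ext z
  simp only [endpoints, segments_succ, Set.mem_iUnion, Set.mem_image, Set.mem_ofPred_eq]
  constructor
  · rintro ⟨_, ⟨i, t, ht, rfl⟩, rfl | rfl⟩
    · exact ⟨i, _, ⟨t, ht, Or.inl rfl⟩, rfl⟩
    · exact ⟨i, _, ⟨t, ht, Or.inr rfl⟩, rfl⟩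
  · rintro ⟨i, _, ⟨t, ht, rfl | rfl⟩, rfl⟩
    · exact ⟨_, ⟨i, t, ht, rfl⟩, Or.inl rfl⟩
    · exact ⟨_, ⟨i, t, ht, rfl⟩, Or.inr rfl⟩

theorem endpoints_zero : endpoints 0 = {0, 1} := by
  ext z; simp [endpoints, segments]

theorem iUnion_endpoints_eq : ⋃ n, endpoints n = ⋃ i, ifs i '' ⋃ n, endpoints n := by
  have h0 : ifs 0 0 = 0 := by apply ext_coords <;> simp
  have h1 : ifs 3 1 = 1 := by apply ext_coords <;> simp <;> norm_num
  apply Set.Subset.antisymm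
  · refine Set.iUnion_subset fun n => ?_
    cases n with
    | zero =>
      rw [endpoints_zero]
      rintro z (rfl | rfl)
      · exact Set.mem_iUnion.2 ⟨0, 0, Set.mem_iUnion.2 ⟨0, by simp [endpoints_zero]⟩, h0⟩
      · exact Set.mem_iUnion.2 ⟨3, 1, Set.mem_iUnion.2 ⟨0, by simp [endpoints_zero]⟩, h1⟩
    | succ n =>
      rw [endpoints_succ]
      exact Set.iUnion_mono fun i => Set.image_mono (Set.subset_iUnion _ n)
  · refine Set.iUnion_subset fun i => ?_
    rintro _ ⟨z, hz, rfl⟩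
    obtain ⟨n, hn⟩ := Set.mem_iUnion.1 hz
    refine Set.mem_iUnion.2 ⟨n + 1, ?_⟩
    rw [endpoints_succ]
    exact Set.mem_iUnion.2 ⟨i, z, hn, rfl⟩

theorem curve_eq : curve = ⋃ i, ifs i '' curve := by
  conv_lhs => rw [curve, iUnion_endpoints_eq, closure_iUnion_of_finite]
  simp only [← image_closure_ifs, curve]

theorem ifs_mem_curve (i : Fin 4) {x : ℂ} (hx : x ∈ curve) : ifs i x ∈ curve := by
  rw [curve_eq]
  exact Set.mem_iUnion.2 ⟨i, x, hx, rfl⟩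

theorem zero_mem_curve : (0 : ℂ) ∈ curve :=
  subset_closure (Set.mem_iUnion.2 ⟨0, by simp [endpoints_zero]⟩)

theorem one_mem_curve : (1 : ℂ) ∈ curve :=
  subset_closure (Set.mem_iUnion.2 ⟨0, by simp [endpoints_zero]⟩)

theorem curve_subset_attractor : curve ⊆ attractor := by
  refine closure_minimal (Set.iUnion_subset fun n => ?_) isClosed_attractor
  induction n with
  | zero =>
    rw [endpoints_zero]
    rintro z (rfl | rfl) <;> apply base_subset_attractor <;> simp [equi]
  | succ n ih =>
    rw [endpoints_succ]
    refine Set.iUnion_subset fun i => ?_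
    rintro _ ⟨z, hz, rfl⟩
    exact ifs_mem_attractor i (ih hz)

theorem isClosed_curve : IsClosed curve := isClosed_closure

/-- A point in no triangle is the image of another such point under one of the contractions,
indefinitely, so it is a limit of points of the curve. Off the curve this allows induction on
`Cell`. -/
theorem cell_of_mem_attractor {x : ℂ} (hx : x ∈ attractor) (hK : x ∉ curve) : Cell x := by
  by_contra hc
  have h : {x | x ∈ attractor ∧ ¬ Cell x} ⊆ closure curve := by
    apply subset_closure_of_contraction (isBounded_equi.subset fun x hx =>
      attractor_subset_equi hx.1) ⟨0, zero_mem_curve⟩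
    rintro x ⟨hx, hc⟩
    rw [attractor_eq] at hx
    rcases hx with hx | hx
    · exact absurd (Cell.tri hx) hc
    · obtain ⟨i, y, hy, rfl⟩ := Set.mem_iUnion.1 hx
      exact Or.inr ⟨y, ⟨hy, fun h => hc (Cell.step i h)⟩, ifs i, dist_ifs_le i,
        fun a => ifs_mem_curve i, rfl⟩
  have := h ⟨hx, hc⟩
  rw [isClosed_curve.closure_eq] at this
  exact hK this

/-! ### Areas -/

theorem det_mulLeft (c : ℂ) : LinearMap.det (LinearMap.mulLeft ℝ c) = Complex.normSq c := by
  rw [← Algebra.norm_complex_apply]; rfl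

theorem volume_real_image_sim (p c : ℂ) (S : Set ℂ) :
    volume.real (sim p c '' S) = Complex.normSq c * volume.real S := by
  have h : sim p c '' S = (fun x => p + x) '' (LinearMap.mulLeft ℝ c '' S) := by
    rw [Set.image_image]; rfl
  rw [measureReal_def, h, Set.image_add_left, measure_preimage_add,
    Measure.addHaar_image_linearMap, det_mulLeft, ENNReal.toReal_mul, ENNReal.toReal_ofReal
    (abs_nonneg _), abs_of_nonneg (Complex.normSq_nonneg c), measureReal_def]

theorem integral_image_sim (p : ℂ) {c : ℂ} (hc : c ≠ 0) {S : Set ℂ} (hS : MeasurableSet S)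
    (g : ℂ → ℂ) :
    ∫ z in sim p c '' S, g z = Complex.normSq c * ∫ z in S, g (sim p c z) := by
  let L : ℂ →L[ℝ] ℂ := (LinearMap.mulLeft ℝ c).toContinuousLinearMap
  have hd : ∀ x ∈ S, HasFDerivWithinAt (sim p c) L S x := fun x _ =>
    (L.hasFDerivAt.const_add p).hasFDerivWithinAt
  rw [integral_image_eq_integral_abs_det_fderiv_smul volume hS hd (injective_sim hc).injOn]
  have : |L.det| = Complex.normSq c := by
    rw [← abs_of_nonneg (Complex.normSq_nonneg c), ← det_mulLeft]; rfl
  simp only [this, Complex.real_smul]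
  rw [integral_const_mul]

/-- Equality in finite subadditivity leaves no room for an overlap: the measure of `s i ∩ s j` would
be counted twice in the sum. -/
theorem aedisjoint_of_sum_le {α ι : Type*} [MeasurableSpace α] {μ : Measure α} [Fintype ι]
    {s : ι → Set α} (hm : ∀ i, MeasurableSet (s i)) (hf : ∀ i, μ (s i) ≠ ⊤)
    (h : ∑ i, μ.real (s i) ≤ μ.real (⋃ i, s i)) : Pairwise (Function.onFun (AEDisjoint μ) s) := by
  classical
  intro i j hij
  have hsub : ⋃ k, s k ⊆ (s i ∪ s j) ∪ ⋃ k ∈ ({i, j} : Finset ι)ᶜ, s k := by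
    refine Set.iUnion_subset fun k => ?_
    by_cases hk : k ∈ ({i, j} : Finset ι)
    · rcases Finset.mem_insert.1 hk with rfl | hk
      · exact Set.subset_union_left.trans Set.subset_union_left
      · rw [Finset.mem_singleton.1 hk]
        exact Set.subset_union_right.trans Set.subset_union_left
    · exact (Set.subset_biUnion_of_mem (u := s) (show k ∈ ({i, j} : Finset ι)ᶜ from
        Finset.mem_compl.2 hk)).trans Set.subset_union_right
  have hfin : μ ((s i ∪ s j) ∪ ⋃ k ∈ ({i, j} : Finset ι)ᶜ, s k) ≠ ⊤ := by
    refine (measure_union_lt_top (measure_union_lt_top (hf i).lt_top (hf j).lt_top) ?_).ne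
    exact (measure_biUnion_lt_top (Finset.finite_toSet _) fun k _ => (hf k).lt_top)
  have h1 := measureReal_mono hsub hfin
  have h2 := measureReal_union_le (μ := μ) (s i ∪ s j) (⋃ k ∈ ({i, j} : Finset ι)ᶜ, s k)
  have h3 := measureReal_biUnion_finset_le (μ := μ) ({i, j} : Finset ι)ᶜ s
  have h4 := measureReal_union_add_inter (μ := μ) (s := s i) (hm j) (hf i) (hf j)
  have h5 := Finset.sum_add_sum_compl ({i, j} : Finset ι) fun k => μ.real (s k)
  rw [Finset.sum_pair hij] at h5
  have h6 : μ.real (s i ∩ s j) = 0 := le_antisymm (by linarith) measureReal_nonneg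
  rwa [measureReal_eq_zero_iff (measure_ne_top_of_subset Set.inter_subset_left (hf i))] at h6

theorem integral_region {S : Set ℂ} (hS : IsCompact S) {l u : ℝ → ℝ} {h : ℝ} (h0 : 0 ≤ h)
    (hSe : ∀ x y : ℝ, (⟨x, y⟩ : ℂ) ∈ S ↔ y ∈ Set.Icc 0 h ∧ x ∈ Set.Icc (l y) (u y))
    (hlu : ∀ y ∈ Set.Icc 0 h, l y ≤ u y) {f : ℂ → ℝ} (hf : Continuous f) :
    ∫ z in S, f z = ∫ y in (0)..h, ∫ x in (l y)..(u y), f ⟨x, y⟩ := by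
  have hint : Integrable (S.indicator f) :=
    (hf.continuousOn.integrableOn_compact hS).integrable_indicator hS.measurableSet
  have mp := Complex.volume_preserving_equiv_real_prod.symm
  have hint2 : Integrable (fun p : ℝ × ℝ => S.indicator f ⟨p.1, p.2⟩) := by
    have := (mp.integrable_comp_emb (MeasurableEquiv.measurableEmbedding _)).2 hint
    exact this
  rw [← integral_indicator hS.measurableSet, ← mp.integral_comp'
    (g := S.indicator f)]
  change ∫ p : ℝ × ℝ, S.indicator f ⟨p.1, p.2⟩ = _
  rw [Measure.volume_eq_prod, integral_prod_symm _ hint2,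
    intervalIntegral.integral_of_le h0, ← integral_Icc_eq_integral_Ioc,
    ← integral_indicator measurableSet_Icc]
  congr 1
  ext y
  by_cases hy : y ∈ Set.Icc 0 h
  · rw [Set.indicator_of_mem hy, intervalIntegral.integral_of_le (hlu y hy),
      ← integral_Icc_eq_integral_Ioc, ← integral_indicator measurableSet_Icc]
    congr 1
    ext x
    by_cases hx : x ∈ Set.Icc (l y) (u y)
    · rw [Set.indicator_of_mem hx, Set.indicator_of_mem ((hSe x y).2 ⟨hy, hx⟩)]
    · rw [Set.indicator_of_notMem hx, Set.indicator_of_notMem fun h => hx ((hSe x y).1 h).2]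
  · rw [Set.indicator_of_notMem hy, integral_eq_zero_of_ae]
    refine Eventually.of_forall fun x => ?_
    exact Set.indicator_of_notMem (fun h => hy ((hSe x y).1 h).1) _

theorem integral_quadratic (a b c h : ℝ) :
    ∫ y in (0)..h, (a + b * y + c * y ^ 2) = a * h + b * h ^ 2 / 2 + c * h ^ 3 / 3 := by
  have hb : ∫ y in (0)..h, b * y = b * ∫ y in (0)..h, y :=
    intervalIntegral.integral_const_mul _ _
  rw [intervalIntegral.integral_add (Continuous.intervalIntegrable (by fun_prop) _ _)
      (Continuous.intervalIntegrable (by fun_prop) _ _),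
    intervalIntegral.integral_add (Continuous.intervalIntegrable (by fun_prop) _ _)
      (Continuous.intervalIntegrable (by fun_prop) _ _)]
  simp only [hb, intervalIntegral.integral_const, intervalIntegral.integral_const_mul, integral_pow,
    integral_id, smul_eq_mul]
  norm_num
  ring

theorem isCompact_tri : IsCompact tri :=
  isCompact_equi.of_isClosed_subset isClosed_tri tri_subset_equi

theorem integral_tri {f : ℂ → ℝ} (hf : Continuous f) :
    ∫ z in tri, f z = ∫ y in (0)..(√3 / 6), ∫ x in (1 / 3 + √3 * y)..(2 / 3 + √3 / 3 * y),
      f ⟨x, y⟩ := by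
  have h3 : 0 < √3 := by positivity
  have h := sqrt_three_sq
  refine integral_region isCompact_tri (l := fun y => 1 / 3 + √3 * y)
    (u := fun y => 2 / 3 + √3 / 3 * y) (by positivity) (fun x y => ?_) (fun y hy => ?_) hf
  · have e : y / √3 = √3 / 3 * y := by field_simp; linear_combination (-y) * h
    simp only [tri, Set.mem_ofPred_eq, uc, sc, Set.mem_Icc, mul_div_assoc, e]
    constructor
    · rintro ⟨h1, h2, h4⟩
      have hy : 0 ≤ y := by
        by_contra hn
        nlinarith
      refine ⟨⟨hy, ?_⟩, ?_, ?_⟩ <;> nlinarith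
    · rintro ⟨⟨h1, h2⟩, h4, h5⟩
      refine ⟨by positivity, ?_, ?_⟩ <;> nlinarith
  · have := hy.2
    nlinarith

theorem volume_real_equi : volume.real equi = √3 / 4 := by
  have h3 : 0 < √3 := by positivity
  have h := sqrt_three_sq
  have key := integral_region isCompact_equi (l := fun y => √3 / 3 * y)
    (u := fun y => 1 - √3 / 3 * y) (h := √3 / 2) (by positivity) (fun x y => ?_)
    (fun y hy => ?_) (f := fun _ => 1) (by fun_prop)
  · simp only [integral_const, smul_eq_mul, mul_one, intervalIntegral.integral_const,
      measureReal_restrict_apply_univ] at key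
    have e : ∀ y : ℝ, 1 - √3 / 3 * y - √3 / 3 * y = 1 + (-(2 * √3 / 3)) * y + 0 * y ^ 2 := by
      intro y; ring
    simp only [e] at key
    rw [key, integral_quadratic]
    linear_combination (-√3 / 12) * h
  · have e : y / √3 = √3 / 3 * y := by field_simp; linear_combination (-y) * h
    simp only [equi, Set.mem_ofPred_eq, uc, sc, Set.mem_Icc, mul_div_assoc, e]
    constructor
    · rintro ⟨h1, h2, h4⟩
      have hy : 0 ≤ y := by
        by_contra hn
        nlinarith
      refine ⟨⟨hy, ?_⟩, ?_, ?_⟩ <;> nlinarith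
    · rintro ⟨⟨h1, h2⟩, h4, h5⟩
      refine ⟨by linarith, by positivity, by linarith⟩
  · have := hy.2
    nlinarith

theorem volume_real_tri : volume.real tri = √3 / 36 := by
  have h := sqrt_three_sq
  have key := integral_tri (f := fun _ => 1) (by fun_prop)
  simp only [integral_const, smul_eq_mul, mul_one, intervalIntegral.integral_const,
    measureReal_restrict_apply_univ] at key
  have e : ∀ y : ℝ, 2 / 3 + √3 / 3 * y - (1 / 3 + √3 * y) =
      1 / 3 + (-(2 * √3 / 3)) * y + 0 * y ^ 2 := by
    intro y; ring
  simp only [e] at key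
  rw [key, integral_quadratic]
  linear_combination (-√3 / 108) * h

theorem integral_tri_im : ∫ z in tri, z.im = 1 / 216 := by
  have h := sqrt_three_sq
  rw [integral_tri Complex.continuous_im]
  simp only [intervalIntegral.integral_const, smul_eq_mul]
  have e : ∀ y : ℝ, (2 / 3 + √3 / 3 * y - (1 / 3 + √3 * y)) * y =
      0 + 1 / 3 * y + (-(2 * √3 / 3)) * y ^ 2 := by
    intro y; ring
  simp only [e]
  rw [integral_quadratic]
  linear_combination (1 / 216 - (√3 * √3 + 3) / 972) * h

theorem integral_tri_re : ∫ z in tri, z.re = 11 * √3 / 648 := by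
  have h := sqrt_three_sq
  rw [integral_tri Complex.continuous_re]
  simp only [integral_id]
  have e : ∀ y : ℝ, ((2 / 3 + √3 / 3 * y) ^ 2 - (1 / 3 + √3 * y) ^ 2) / 2 =
      1 / 6 + (-√3 / 9) * y + (-(4 / 3)) * y ^ 2 := by
    intro y; linear_combination (-4 / 9 * y ^ 2) * h
  simp only [e]
  rw [integral_quadratic]
  linear_combination (-√3 / 162 - √3 / 648 + √3 / 243) * h

/-! ### The tiling of the equilateral triangle -/

/-- The union of the attractor and its rotated copies. -/
def tiles : Set ℂ := {z | z ∈ attractor ∨ rot z ∈ attractor ∨ rot (rot z) ∈ attractor}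

theorem rot_mem_tiles {z : ℂ} (hz : z ∈ tiles) : rot z ∈ tiles := by
  rcases hz with hz | hz | hz
  · refine Or.inr (Or.inr ?_); rwa [rot_rot_rot]
  · exact Or.inl hz
  · exact Or.inr (Or.inl hz)

theorem ifs3_mem_tiles {z : ℂ} (hz : z ∈ tiles) : ifs 3 z ∈ tiles := by
  rcases hz with hz | hz | hz
  · exact Or.inl (ifs_mem_attractor 3 hz)
  · rw [← rot_rot_rot z, ifs3_rot_rot]
    exact Or.inl (ifs_mem_attractor 2 hz)
  · rw [← rot_rot_rot z, ifs3_rot]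
    exact rot_mem_tiles (Or.inl (ifs_mem_attractor 0 hz))

theorem ifs1_mem_tiles {z : ℂ} (hz : z ∈ tiles) : ifs 1 z ∈ tiles := by
  rcases hz with hz | hz | hz
  · exact Or.inl (ifs_mem_attractor 1 hz)
  · rw [← rot_rot_rot z, ifs1_rot, ifs1_rot]
    exact rot_mem_tiles (rot_mem_tiles (Or.inl (ifs_mem_attractor 1 hz)))
  · rw [← rot_rot_rot z, ifs1_rot]
    exact rot_mem_tiles (Or.inl (ifs_mem_attractor 1 hz))

theorem isClosed_tiles : IsClosed tiles :=
  isClosed_attractor.union ((isClosed_attractor.preimage continuous_rot).union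
    (isClosed_attractor.preimage (continuous_rot.comp continuous_rot)))

/-- The equilateral triangle splits into three corner triangles of ratio `1/3`, three rotated copies
of `tri`, and the central triangle `ifs 1 '' equi`. The copies of `tri` lie in the tiles; the other
parts are contracted copies of the whole, under maps that preserve the tiles. -/
theorem equi_subset_tiles : equi ⊆ tiles := by
  have corner : ∀ x ∈ equi, 2 / 3 ≤ sc x → ∃ y ∈ equi, ifs 3 y = x := by
    rintro x ⟨h1, h2, h3⟩ h
    refine ⟨3 * x - 2, ⟨?_, ?_, ?_⟩, ?_⟩
    · simp; linarith
    · simp; linarith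
    · simp; linarith
    · apply ext_coords <;> simp
  suffices h : equi ⊆ closure tiles by rwa [isClosed_tiles.closure_eq] at h
  refine subset_closure_of_contraction isBounded_equi
    ⟨1 / 2, Or.inl (tri_subset_attractor (by norm_num [tri]))⟩ fun x hx => ?_
  by_cases c1 : 2 / 3 ≤ sc x
  · obtain ⟨y, hy, rfl⟩ := corner x hx c1
    exact Or.inr ⟨y, hy, ifs 3, dist_ifs_le 3, fun a => ifs3_mem_tiles, rfl⟩
  by_cases c2 : 2 / 3 ≤ sc (rot x)
  · obtain ⟨y, hy, h⟩ := corner _ (rot_mem_equi hx) c2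
    refine Or.inr ⟨y, hy, fun z => rot (rot (ifs 3 z)), fun a b => ?_, fun a ha =>
      rot_mem_tiles (rot_mem_tiles (ifs3_mem_tiles ha)), by simp only [h, rot_rot_rot]⟩
    rw [dist_rot, dist_rot]
    exact dist_ifs_le 3 a b
  by_cases c3 : 2 / 3 ≤ sc (rot (rot x))
  · obtain ⟨y, hy, h⟩ := corner _ (rot_mem_equi (rot_mem_equi hx)) c3
    refine Or.inr ⟨y, hy, fun z => rot (ifs 3 z), fun a b => ?_, fun a ha =>
      rot_mem_tiles (ifs3_mem_tiles ha), by simp only [h, rot_rot_rot]⟩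
    rw [dist_rot]
    exact dist_ifs_le 3 a b
  obtain ⟨h1, h2, h3⟩ := hx
  by_cases t1 : 1 / 3 + uc x ≤ sc x
  · exact Or.inl (Or.inl (tri_subset_attractor ⟨h2, by linarith, t1⟩))
  by_cases t2 : 1 / 3 + uc (rot x) ≤ sc (rot x)
  · refine Or.inl (Or.inr (Or.inl (tri_subset_attractor ⟨?_, by linarith, t2⟩)))
    simpa using h1
  by_cases t3 : 1 / 3 + uc (rot (rot x)) ≤ sc (rot (rot x))
  · refine Or.inl (Or.inr (Or.inr (tri_subset_attractor ⟨?_, by linarith, t3⟩)))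
    simp; linarith
  simp only [sc_rot, uc_rot, not_le] at t1 t2 t3
  -- The preimage under `ifs 1`, since `(2 - ω)(1 + ω) = 3`; the failed inequalities `t1`, `t2`,
  -- `t3` place it in `equi`.
  refine Or.inr ⟨(2 - omega) * (x - 1 / 3), ⟨?_, ?_, ?_⟩, ifs 1, dist_ifs_le 1,
    fun a => ifs1_mem_tiles, ?_⟩
  · simp; linarith
  · simp; linarith
  · simp; linarith
  · apply ext_coords <;> simp <;> ring

theorem volume_real_image_ifs (i : Fin 4) (S : Set ℂ) :
    volume.real (ifs i '' S) = ![1 / 9, 1 / 3, 1 / 9, 1 / 9] i * volume.real S := by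
  rw [← normSq_coef]; exact volume_real_image_sim _ _ _

theorem volume_real_image_rot (S : Set ℂ) : volume.real (rot '' S) = volume.real S := by
  rw [rot, volume_real_image_sim, map_pow, normSq_omega, one_pow, one_mul]

/-- The triangle and the four reduced copies that make up the attractor. -/
def piece : Option (Fin 4) → Set ℂ
  | none => tri
  | some i => ifs i '' attractor

theorem attractor_eq_iUnion_piece : attractor = ⋃ o, piece o := by
  conv_lhs => rw [attractor_eq]
  rw [Set.iUnion_option]
  rfl

theorem isCompact_piece (o : Option (Fin 4)) : IsCompact (piece o) := by
  cases o with
  | none => exact isCompact_tri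
  | some i => exact isCompact_attractor.image (continuous_ifs i)

theorem sum_volume_real_piece :
    ∑ o, volume.real (piece o) = √3 / 36 + 2 / 3 * volume.real attractor := by
  rw [Fintype.sum_option]
  simp only [piece, volume_real_tri, volume_real_image_ifs, Fin.sum_univ_four]
  simp
  ring

/-- The attractor and its two rotated copies. -/
def rotPiece : Fin 3 → Set ℂ := ![attractor, rot '' attractor, rot '' (rot '' attractor)]

theorem isCompact_rotPiece (k : Fin 3) : IsCompact (rotPiece k) := by
  have h1 := isCompact_attractor.image continuous_rot
  fin_cases k
  · exact isCompact_attractor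
  · exact h1
  · exact h1.image continuous_rot

theorem tiles_eq_iUnion_rotPiece : tiles = ⋃ k, rotPiece k := by
  ext z
  simp only [tiles, Set.mem_ofPred_eq, Set.mem_iUnion, Fin.exists_fin_succ, rotPiece]
  simp only [Matrix.cons_val_zero, Matrix.cons_val_succ, Set.mem_image, exists_exists_and_eq_and,
    IsEmpty.exists_iff, or_false]
  refine or_congr_right (Iff.trans or_comm (or_congr ?_ ?_))
  · exact ⟨fun h => ⟨_, h, rot_rot_rot z⟩, by rintro ⟨y, hy, rfl⟩; rwa [rot_rot_rot]⟩
  · exact ⟨fun h => ⟨_, h, rot_rot_rot z⟩, by rintro ⟨y, hy, rfl⟩; rwa [rot_rot_rot]⟩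

theorem sum_volume_real_rotPiece :
    ∑ k, volume.real (rotPiece k) = 3 * volume.real attractor := by
  simp only [Fin.sum_univ_three, rotPiece, Matrix.cons_val, volume_real_image_rot]
  ring

theorem tiles_subset_equi : tiles ⊆ equi := by
  have h : ∀ z, rot z ∈ equi → z ∈ equi := fun z hz => by
    rw [← rot_rot_rot z]; exact rot_mem_equi (rot_mem_equi hz)
  rintro z (hz | hz | hz)
  · exact attractor_subset_equi hz
  · exact h _ (attractor_subset_equi hz)
  · exact h _ (h _ (attractor_subset_equi hz))

theorem tiles_eq : tiles = equi := tiles_subset_equi.antisymm equi_subset_tiles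

theorem volume_real_attractor : volume.real attractor = √3 / 12 := by
  have h1 := measureReal_iUnion_fintype_le (μ := volume) piece
  rw [← attractor_eq_iUnion_piece, sum_volume_real_piece] at h1
  have h2 := measureReal_iUnion_fintype_le (μ := volume) rotPiece
  rw [← tiles_eq_iUnion_rotPiece, tiles_eq, sum_volume_real_rotPiece, volume_real_equi] at h2
  linarith

theorem aedisjoint_piece : Pairwise (Function.onFun (AEDisjoint volume) piece) := by
  refine aedisjoint_of_sum_le (fun o => (isCompact_piece o).measurableSet)
    (fun o => (isCompact_piece o).measure_ne_top) ?_
  rw [← attractor_eq_iUnion_piece, sum_volume_real_piece, volume_real_attractor]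
  linarith

theorem aedisjoint_rotPiece : Pairwise (Function.onFun (AEDisjoint volume) rotPiece) := by
  refine aedisjoint_of_sum_le (fun o => (isCompact_rotPiece o).measurableSet)
    (fun o => (isCompact_rotPiece o).measure_ne_top) ?_
  rw [← tiles_eq_iUnion_rotPiece, tiles_eq, sum_volume_real_rotPiece, volume_real_attractor,
    volume_real_equi]
  linarith

theorem isCompact_curve : IsCompact curve :=
  isCompact_attractor.of_isClosed_subset isClosed_curve curve_subset_attractor

/-- The area ratios sum to `2/3 < 1`, so a finite area bounded by `2/3` of itself vanishes. -/
theorem volume_curve : volume curve = 0 := by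
  have h := measureReal_iUnion_fintype_le (μ := volume) fun i => ifs i '' curve
  rw [← curve_eq] at h
  simp only [volume_real_image_ifs, Fin.sum_univ_four] at h
  simp only [Matrix.cons_val] at h
  have h0 := measureReal_nonneg (μ := volume) (s := curve)
  rw [← measureReal_eq_zero_iff isCompact_curve.measure_ne_top]
  linarith

/-! ### The first moment of the attractor -/

theorem integral_attractor_eq : ∫ z in attractor, z =
    (∫ z in tri, z) + ∑ i, (Complex.normSq (coef i) : ℂ) *
      (orig i * (√3 / 12 : ℝ) + coef i * ∫ z in attractor, z) := by
  have hint : IntegrableOn (fun z : ℂ => z) attractor :=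
    continuous_id.continuousOn.integrableOn_compact isCompact_attractor
  conv_lhs => rw [attractor_eq_iUnion_piece]
  rw [integral_iUnion_ae (fun o => (isCompact_piece o).measurableSet.nullMeasurableSet)
    aedisjoint_piece (by rwa [← attractor_eq_iUnion_piece]), tsum_fintype, Fintype.sum_option]
  congr 1
  refine Finset.sum_congr rfl fun i _ => ?_
  rw [piece, ifs, integral_image_sim _ (coef_ne_zero i) isClosed_attractor.measurableSet]
  congr 1
  simp only [sim]
  rw [integral_add, integral_const, measureReal_restrict_apply_univ, volume_real_attractor,
    integral_const_mul, Complex.real_smul, mul_comm]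
  · exact continuous_const.continuousOn.integrableOn_compact isCompact_attractor
  · exact hint.const_mul _

theorem integral_attractor_im : (∫ z in attractor, z).im = 17 / 888 := by
  have h := sqrt_three_sq
  have hint : IntegrableOn (fun z : ℂ => z) tri :=
    continuous_id.continuousOn.integrableOn_compact isCompact_tri
  have hre : (∫ z in tri, z).re = 11 * √3 / 648 := by
    rw [← integral_tri_re]; exact (integral_re hint).symm
  have him : (∫ z in tri, z).im = 1 / 216 := by
    rw [← integral_tri_im]; exact (integral_im hint).symm
  have key := integral_attractor_eq
  rw [Fin.sum_univ_four, normSq_coef, normSq_coef, normSq_coef, normSq_coef] at key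
  simp only [coef, orig, Matrix.cons_val] at key
  have k1 := congrArg Complex.re key
  have k2 := congrArg Complex.im key
  simp only [Complex.add_re, Complex.add_im, Complex.mul_re, Complex.mul_im, Complex.ofReal_re,
    Complex.ofReal_im, hre, him, omega_re, omega_im, Complex.div_ofNat_re, Complex.div_ofNat_im,
    Complex.neg_re, Complex.neg_im, Complex.one_re, Complex.one_im, Complex.zero_re,
    Complex.zero_im, Complex.re_ofNat, Complex.im_ofNat] at k1 k2
  set X := (∫ z in attractor, z).re
  set Y := (∫ z in attractor, z).im
  ring_nf at k1 k2 h
  rw [h] at k2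
  -- The moment is multiplied by `1 - (5 + 2ω)/27 = 7/9 - i√3/27`, of squared modulus `444/729`. The
  -- weights of `k1` and `k2` take the imaginary part after multiplication by its inverse.
  linear_combination (729 / 444) * ((√3 / 27) * k1 + 7 / 9 * k2) + (13 / 5328 - Y / 444) * h

/-! ### Local structure of the attractor -/

/-- Otherwise the interiors of `P` and `Q` would meet in a nonempty open set, which has positive
area. -/
theorem notMem_of_mem_nhds {P Q : Set ℂ} {x : ℂ} (hQ : Q ⊆ closure (interior Q))
    (h : AEDisjoint volume P Q) (hx : P ∈ 𝓝 x) : x ∉ Q := by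
  intro hxQ
  obtain ⟨y, hyP, hyQ⟩ := mem_closure_iff_nhds.1 (hQ hxQ) (interior P) (interior_mem_nhds.2 hx)
  have hpos := (isOpen_interior.inter isOpen_interior).measure_pos volume ⟨y, hyP, hyQ⟩
  exact hpos.ne' (measure_mono_null (Set.inter_subset_inter interior_subset interior_subset) h)

/-- The open lower half plane. -/
def lower : Set ℂ := {z | uc z < 0}

theorem disjoint_lower_equi : Disjoint lower equi :=
  Set.disjoint_left.2 fun _ h h' => absurd h'.2.1 (not_le.2 h)

theorem ifs_notMem_of_eventually {i : Fin 4} {x : ℂ}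
    (h : ∀ᶠ w in 𝓝 x, ifs i w ∈ ifs i '' attractor ∪ tri ∪ lower) {j : Fin 4} (hj : j ≠ i) :
    ifs i x ∉ ifs j '' attractor := by
  have h' : ifs i '' attractor ∪ tri ∪ lower ∈ 𝓝 (ifs i x) := by
    rw [← map_nhds_ifs]; exact h
  refine notMem_of_mem_nhds (ifs_attractor_subset_closure_interior j) ?_ h'
  refine AEDisjoint.union_left (AEDisjoint.union_left ?_ ?_) ?_
  · exact aedisjoint_piece (i := some i) (j := some j) (by simpa using hj.symm)
  · exact aedisjoint_piece (i := none) (j := some j) (by simp)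
  · exact (disjoint_lower_equi.mono_right
      ((image_ifs_subset_attractor j).trans attractor_subset_equi)).aedisjoint

theorem notMem_curve_of_tri_mem_nhds {x : ℂ} (h : tri ∪ lower ∈ 𝓝 x) : x ∉ curve := by
  intro hx
  rw [curve_eq] at hx
  obtain ⟨j, hj⟩ := Set.mem_iUnion.1 hx
  refine notMem_of_mem_nhds (ifs_attractor_subset_closure_interior j) ?_ h
    (Set.image_mono curve_subset_attractor hj)
  refine AEDisjoint.union_left ?_ ?_
  · exact aedisjoint_piece (i := none) (j := some j) (by simp)
  · exact (disjoint_lower_equi.mono_right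
      ((image_ifs_subset_attractor j).trans attractor_subset_equi)).aedisjoint

/-- On the open middle third, `tri` fills the upper side. The points `1/3` and `2/3` are on the
curve, and the outer thirds magnify to the whole base. Base points where the property fails are
therefore limits of points of the curve. -/
theorem eventually_mem_attractor_of_base {x : ℂ} (hx : x ∈ equi) (hu : uc x = 0)
    (hK : x ∉ curve) : ∀ᶠ w in 𝓝 x, 0 ≤ uc w → w ∈ attractor := by
  by_contra hne
  have h : {x | x ∈ equi ∧ uc x = 0 ∧ ¬ ∀ᶠ w in 𝓝 x, 0 ≤ uc w → w ∈ attractor} ⊆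
      closure curve := by
    refine subset_closure_of_contraction (isBounded_equi.subset fun x hx => hx.1)
      ⟨0, zero_mem_curve⟩ ?_
    rintro x ⟨⟨h1, h2, h3⟩, hu, hne⟩
    rcases lt_trichotomy (sc x) (1 / 3) with hs | hs | hs
    · have e : ifs 0 (3 * x) = x := by apply ext_coords <;> simp
      refine Or.inr ⟨3 * x, ⟨⟨?_, ?_, ?_⟩, ?_, fun hev => hne ?_⟩, ifs 0, dist_ifs_le 0,
        fun a => ifs_mem_curve 0, e⟩
      · simp; linarith
      · simp; linarith
      · simp; linarith
      · simp; linarith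
      · rw [← e, ← map_nhds_ifs, eventually_map]
        filter_upwards [hev] with w hw hw0
        exact ifs_mem_attractor 0 (hw (by simp at hw0; linarith))
    · left
      have e : ifs 0 1 = x := by apply ext_coords <;> simp [hs, hu]
      exact e ▸ ifs_mem_curve 0 one_mem_curve
    rcases lt_trichotomy (sc x) (2 / 3) with ht | ht | ht
    · refine absurd ?_ hne
      have e1 := continuous_sc.continuousAt.eventually (gt_mem_nhds ht)
      have e2 : ∀ᶠ w in 𝓝 x, 1 / 3 + uc w < sc w :=
        ContinuousAt.eventually_lt (by fun_prop) (by fun_prop) (by linarith)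
      filter_upwards [e1, e2] with w w1 w2 w3 using tri_subset_attractor ⟨w3, w1.le, w2.le⟩
    · left
      have e : ifs 3 0 = x := by apply ext_coords <;> simp [ht, hu]
      exact e ▸ ifs_mem_curve 3 zero_mem_curve
    · have e : ifs 3 (3 * x - 2) = x := by apply ext_coords <;> simp
      refine Or.inr ⟨3 * x - 2, ⟨⟨?_, ?_, ?_⟩, ?_, fun hev => hne ?_⟩, ifs 3, dist_ifs_le 3,
        fun a => ifs_mem_curve 3, e⟩
      · simp; linarith
      · simp; linarith
      · simp; linarith
      · simp; linarith
      · rw [← e, ← map_nhds_ifs, eventually_map]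
        filter_upwards [hev] with w hw hw0
        exact ifs_mem_attractor 3 (hw (by simp at hw0; linarith))
  have := h ⟨hx, hu, hne⟩
  rw [isClosed_curve.closure_eq] at this
  exact hK this

/-- Only points just below the base need care: `ifs 1` and `ifs 2` send them into `tri`, across its
sides `BC` and `CD`, while `ifs 0` and `ifs 3` send them below the base. The ends of the base are
excluded because they lie on the curve. -/
theorem eventually_ifs_mem {x : ℂ} (hx : x ∈ equi) (hK : x ∉ curve)
    (h : uc x = 0 ∨ attractor ∈ 𝓝 x) (i : Fin 4) :
    ∀ᶠ w in 𝓝 x, ifs i w ∈ ifs i '' attractor ∪ tri ∪ lower := by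
  rcases h with hu | h
  swap
  · filter_upwards [h] with w hw using Or.inl (Or.inl ⟨w, hw, rfl⟩)
  have h0 : 0 < sc x := by
    refine lt_of_le_of_ne hx.1 fun h => hK ?_
    have : x = 0 := by apply ext_coords <;> simp [← h, hu]
    exact this ▸ zero_mem_curve
  have h1 : sc x < 1 := by
    have h3 := hx.2.2
    rw [hu, add_zero] at h3
    refine lt_of_le_of_ne h3 fun h => hK ?_
    have : x = 1 := by apply ext_coords <;> simp [h, hu]
    exact this ▸ one_mem_curve
  have hA := eventually_mem_attractor_of_base hx hu hK
  have e1 : ∀ᶠ w in 𝓝 x, 0 < sc w + 2 * uc w :=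
    ContinuousAt.eventually_lt (by fun_prop) (by fun_prop) (by rw [hu]; linarith)
  have e2 : ∀ᶠ w in 𝓝 x, sc w < 1 + uc w :=
    ContinuousAt.eventually_lt (by fun_prop) (by fun_prop) (by rw [hu]; linarith)
  have e3 : ∀ᶠ w in 𝓝 x, sc w + uc w < 1 :=
    ContinuousAt.eventually_lt (by fun_prop) (by fun_prop) (by rw [hu]; linarith)
  filter_upwards [hA, e1, e2, e3] with w hA w1 w2 w3
  rcases le_or_gt 0 (uc w) with h0 | h0
  · exact Or.inl (Or.inl ⟨w, hA h0, rfl⟩)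
  fin_cases i
  · right; simp [lower]; linarith
  · left; right
    refine ⟨?_, ?_, ?_⟩ <;> simp <;> linarith
  · left; right
    refine ⟨?_, ?_, ?_⟩ <;> simp <;> linarith
  · right; simp [lower]; linarith

theorem cell_mem_equi {x : ℂ} (hx : Cell x) : x ∈ equi :=
  attractor_subset_equi (cell_subset_attractor hx)

theorem attractor_mem_nhds_ifs {x : ℂ} (hx : x ∈ equi) (hK : x ∉ curve)
    (h : uc x = 0 ∨ attractor ∈ 𝓝 x) {i : Fin 4} (hu : 0 < uc (ifs i x)) :
    attractor ∈ 𝓝 (ifs i x) := by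
  have hw := eventually_ifs_mem hx hK h i
  have hp : ∀ᶠ w in 𝓝 x, 0 < uc (ifs i w) :=
    (continuous_uc.comp (continuous_ifs i)).continuousAt.eventually (lt_mem_nhds hu)
  rw [← map_nhds_ifs, mem_map]
  filter_upwards [hw, hp] with w hw hp
  rcases hw with (hw | hw) | hw
  · exact image_ifs_subset_attractor i hw
  · exact tri_subset_attractor hw
  · exact absurd hw (not_lt.2 hp.le)

/-- Induction on the triangle containing the point. A point on the side `BC` or `CD` of `tri` is the
image under `ifs 1` or `ifs 2` of a base point, so the attractor surrounds it from both sides. -/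
theorem attractor_mem_nhds_of_cell {x : ℂ} (hx : Cell x) (hK : x ∉ curve) (hu : uc x ≠ 0) :
    attractor ∈ 𝓝 x := by
  induction hx with
  | @tri x hx =>
    have hequi := tri_subset_equi hx
    have hu0 : 0 < uc x := lt_of_le_of_ne hx.1 hu.symm
    have side : ∀ (i : Fin 4) (y : ℂ), ifs i y = x → y ∈ equi → uc y = 0 → attractor ∈ 𝓝 x := by
      rintro i y rfl hy hy0
      exact attractor_mem_nhds_ifs hy (fun h => hK (ifs_mem_curve i h)) (Or.inl hy0) hu0
    rcases hx.2.1.lt_or_eq with h1 | h1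
    · rcases hx.2.2.lt_or_eq with h2 | h2
      · exact mem_of_superset (tri_mem_nhds hu0 h1 h2) tri_subset_attractor
      · refine side 1 ((3 * uc x : ℝ)) ?_ ?_ ?_
        · apply ext_coords <;> simp <;> linarith
        · refine ⟨?_, ?_, ?_⟩ <;> simp <;> linarith
        · simp
    · refine side 2 ((1 - 3 * uc x : ℝ)) ?_ ?_ ?_
      · apply ext_coords <;> simp only [sc_ifs2, uc_ifs2, sc_ofReal, uc_ofReal] <;> linarith
      · have := hx.2.2
        refine ⟨?_, ?_, ?_⟩ <;> simp only [sc_ofReal, uc_ofReal] <;> linarith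
      · simp only [uc_ofReal]
  | @step i x hx ih =>
    have hK' : x ∉ curve := fun h => hK (ifs_mem_curve i h)
    have hpos : 0 < uc (ifs i x) :=
      lt_of_le_of_ne (ifs_mem_equi i (cell_mem_equi hx)).2.1 hu.symm
    refine attractor_mem_nhds_ifs (cell_mem_equi hx) hK' ?_ hpos
    by_cases h : uc x = 0
    · exact Or.inl h
    · exact Or.inr (ih hK' h)

theorem uc_eq_zero_or_mem_nhds {x : ℂ} (hx : x ∈ attractor) (hK : x ∉ curve) :
    uc x = 0 ∨ attractor ∈ 𝓝 x :=
  or_iff_not_imp_left.2 (attractor_mem_nhds_of_cell (cell_of_mem_attractor hx hK) hK)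

theorem ifs_notMem_curve {x : ℂ} (hx : x ∈ attractor) (hK : x ∉ curve) (i : Fin 4) :
    ifs i x ∉ curve := by
  intro h
  rw [curve_eq] at h
  obtain ⟨j, hj⟩ := Set.mem_iUnion.1 h
  by_cases hij : j = i
  · subst hij
    obtain ⟨y, hy, hyx⟩ := hj
    exact hK (injective_ifs _ hyx ▸ hy)
  · exact ifs_notMem_of_eventually (eventually_ifs_mem (attractor_subset_equi hx) hK
      (uc_eq_zero_or_mem_nhds hx hK) i) hij (Set.image_mono curve_subset_attractor hj)

/-! ### Connecting the points of the attractor to its base -/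

/-- The straight segment to `1/2` works: after its starting point it stays off the sides `BC` and
`CD`, so `tri` and the lower half plane together surround each of its points, and the curve cannot
pass there. -/
theorem joinedIn_of_tri {x : ℂ} (hx : x ∈ tri) (hK : x ∉ curve) :
    ∃ y, uc y = 0 ∧ JoinedIn (attractor \ curve) x y := by
  refine ⟨1 / 2, by simp, JoinedIn.of_segment_subset ?_⟩
  rintro z ⟨a, b, ha, hb, hab, rfl⟩
  obtain ⟨h1, h2, h3⟩ := hx
  rcases hb.eq_or_lt with rfl | hb
  · obtain rfl : a = 1 := by linarith
    simpa using ⟨tri_subset_attractor ⟨h1, h2, h3⟩, hK⟩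
  have hs : sc (a • x + b • (1 / 2 : ℂ)) = a * sc x + b * (1 / 2) := by
    simp only [Complex.real_smul, sc_add, sc_mul, sc_ofReal, uc_ofReal]
    simp
  have hu : uc (a • x + b • (1 / 2 : ℂ)) = a * uc x := by
    simp only [Complex.real_smul, uc_add, uc_mul, sc_ofReal, uc_ofReal]
    simp
  have i1 : 0 ≤ uc (a • x + b • (1 / 2 : ℂ)) := by rw [hu]; positivity
  have i2 : sc (a • x + b • (1 / 2 : ℂ)) < 2 / 3 := by rw [hs]; nlinarith
  have i3 : 1 / 3 + uc (a • x + b • (1 / 2 : ℂ)) < sc (a • x + b • (1 / 2 : ℂ)) := by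
    rw [hs, hu]; nlinarith
  refine ⟨tri_subset_attractor ⟨i1, i2.le, i3.le⟩, notMem_curve_of_tri_mem_nhds ?_⟩
  have e1 := continuous_sc.continuousAt.eventually (gt_mem_nhds i2)
  have e2 : ∀ᶠ w in 𝓝 (a • x + b • (1 / 2 : ℂ)), 1 / 3 + uc w < sc w :=
    ContinuousAt.eventually_lt (by fun_prop) (by fun_prop) i3
  filter_upwards [e1, e2] with w w1 w2
  rcases le_or_gt 0 (uc w) with h | h
  · exact Or.inl ⟨h, w1.le, w2.le⟩
  · exact Or.inr h

/-- A path to the base of the copy is carried along by `ifs i`. For `i = 0, 3` it ends on the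
original base; for `i = 1, 2` it ends on a side of `tri`, from where it continues through `tri`. -/
theorem joinedIn_of_cell {x : ℂ} (hx : Cell x) (hK : x ∉ curve) :
    ∃ y, uc y = 0 ∧ JoinedIn (attractor \ curve) x y := by
  induction hx with
  | tri hx => exact joinedIn_of_tri hx hK
  | @step i x hx ih =>
    obtain ⟨y, hy0, hy⟩ := ih fun h => hK (ifs_mem_curve i h)
    have hj : JoinedIn (attractor \ curve) (ifs i x) (ifs i y) := by
      refine (hy.map (continuous_ifs i)).mono ?_
      rintro _ ⟨z, hz, rfl⟩
      exact ⟨ifs_mem_attractor i hz.1, ifs_notMem_curve hz.1 hz.2 i⟩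
    obtain ⟨h1, h2, h3⟩ := attractor_subset_equi hy.target_mem.1
    have ht : i = 1 ∨ i = 2 → ∃ y, uc y = 0 ∧ JoinedIn (attractor \ curve) (ifs i x) y := by
      intro hi
      have hyt : ifs i y ∈ tri := by
        rcases hi with rfl | rfl <;> refine ⟨?_, ?_, ?_⟩ <;> simp <;> linarith
      obtain ⟨w, hw0, hw⟩ := joinedIn_of_tri hyt hj.target_mem.2
      exact ⟨w, hw0, hj.trans hw⟩
    fin_cases i
    · exact ⟨_, by simp [hy0], hj⟩
    · exact ht (by simp)
    · exact ht (by simp)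
    · exact ⟨_, by simp [hy0], hj⟩

/-! ### The region is the attractor -/

theorem mem_segment_of_uc_eq_zero {x : ℂ} (hx : x ∈ equi) (hu : uc x = 0) :
    x ∈ segment ℝ (0 : ℂ) 1 := by
  obtain ⟨h1, h2, h3⟩ := hx
  refine ⟨1 - sc x, sc x, by linarith, h1, by ring, ?_⟩
  apply ext_coords <;> simp [hu]

theorem segment_subset_attractor : segment ℝ (0 : ℂ) 1 ⊆ attractor := by
  rintro _ ⟨a, b, ha, hb, hab, rfl⟩
  have e : a • (0 : ℂ) + b • (1 : ℂ) = (b : ℂ) := by simp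
  rw [e]
  apply base_subset_attractor
  · refine ⟨?_, ?_, ?_⟩ <;> simp only [sc_ofReal, uc_ofReal] <;> linarith
  · simp

theorem attractor_subset_region : attractor ⊆ region := by
  intro z hz
  by_cases hX : z ∈ curve ∪ segment ℝ (0 : ℂ) 1
  · exact Or.inl hX
  refine Or.inr ⟨hX, isCompact_attractor.isBounded.subset ?_⟩
  have hcov : ∀ x ∈ (curve ∪ segment ℝ (0 : ℂ) 1)ᶜ, x ∈ attractor → x ∈ interior attractor := by
    intro x hx hxa
    rw [Set.mem_compl_iff, Set.mem_union, not_or] at hx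
    rcases uc_eq_zero_or_mem_nhds hxa hx.1 with h | h
    · exact absurd (mem_segment_of_uc_eq_zero (attractor_subset_equi hxa) h) hx.2
    · exact mem_interior_iff_mem_nhds.2 h
  refine Set.Subset.trans ?_ interior_subset
  -- Off the curve and the base, the attractor has no boundary points, so its interior and its
  -- complement separate the component.
  refine isPreconnected_connectedComponentIn.subset_left_of_subset_union isOpen_interior
    isClosed_attractor.isOpen_compl (disjoint_compl_right.mono_left interior_subset) ?_ ?_
  · intro x hx
    by_cases hxa : x ∈ attractor
    · exact Or.inl (hcov x (connectedComponentIn_subset _ _ hx) hxa)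
    · exact Or.inr hxa
  · exact ⟨z, mem_connectedComponentIn hX, hcov z hX hz⟩

theorem not_isBounded_of_notMem_equi {z : ℂ} (hz : z ∉ equi) :
    ¬ Bornology.IsBounded (connectedComponentIn attractorᶜ z) := by
  have ray : ∀ v : ℂ, v ≠ 0 → (∀ t : ℝ, 0 ≤ t → z + t * v ∉ equi) →
      ¬ Bornology.IsBounded (connectedComponentIn attractorᶜ z) := by
    intro v hv h hb
    have hc : IsPreconnected ((fun t : ℝ => z + t * v) '' Set.Ici 0) :=
      isPreconnected_Ici.image _ (by fun_prop)
    have hsub := hc.subset_connectedComponentIn (x := z) (F := attractorᶜ)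
      ⟨0, Set.self_mem_Ici, by simp⟩ (by
        rintro _ ⟨t, ht, rfl⟩ hmem
        exact h t ht (attractor_subset_equi hmem))
    obtain ⟨C, hC⟩ := (hb.subset hsub).subset_closedBall z
    have hv' : 0 < ‖v‖ := norm_pos_iff.2 hv
    have := hC ⟨(|C| + 1) / ‖v‖, Set.mem_Ici.2 (by positivity), rfl⟩
    rw [Metric.mem_closedBall, dist_eq_norm, add_sub_cancel_left, norm_mul, Complex.norm_real,
      Real.norm_of_nonneg (by positivity), div_mul_cancel₀ _ hv'.ne'] at this
    linarith [le_abs_self C]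
  have ho : omega ≠ 0 := fun h => by simpa using congrArg uc h
  by_cases h1 : 0 ≤ sc z
  swap
  · refine ray (-1) (by simp) fun t ht hm => ?_
    have := hm.1
    simp at this
    linarith
  by_cases h2 : 0 ≤ uc z
  swap
  · refine ray (-omega) (neg_ne_zero.2 ho) fun t ht hm => ?_
    have := hm.2.1
    simp at this
    linarith
  · refine ray 1 one_ne_zero fun t ht hm => hz ⟨h1, h2, ?_⟩
    have := hm.2.2
    simp at this
    linarith

/-- Near `k x` the plane is filled by the rotated attractor and, if `x` is on the base, the rotated
lower half plane. Both are almost disjoint from the attractor. -/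
theorem rot_notMem_attractor {k : ℂ → ℂ} (hk : k = rot ∨ k = rot ∘ rot) {x : ℂ}
    (hx : x ∈ attractor) (hK : x ∉ curve) : k x ∉ attractor := by
  have hmap : map k (𝓝 x) = 𝓝 (k x) := by
    rcases hk with rfl | rfl
    · exact map_nhds_rot x
    · rw [← map_map, map_nhds_rot, map_nhds_rot]; rfl
  have hd : AEDisjoint volume (k '' attractor) attractor := by
    rcases hk with rfl | rfl
    · exact aedisjoint_rotPiece (i := 1) (j := 0) (by decide)
    · rw [Set.image_comp]
      exact aedisjoint_rotPiece (i := 2) (j := 0) (by decide)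
  have hl : Disjoint (k '' lower) attractor := by
    rw [Set.disjoint_left]
    rintro _ ⟨w, hw, rfl⟩ hm
    have hm := attractor_subset_equi hm
    have hw : uc w < 0 := hw
    rcases hk with rfl | rfl
    · have := hm.2.2
      simp at this
      linarith
    · have := hm.1
      simp at this
      linarith
  refine notMem_of_mem_nhds attractor_subset_closure_interior
    (hd.union_left hl.aedisjoint) ?_
  rw [← hmap, mem_map]
  rcases uc_eq_zero_or_mem_nhds hx hK with hu | h
  · filter_upwards [eventually_mem_attractor_of_base (attractor_subset_equi hx) hu hK] with w hw
    rcases le_or_gt 0 (uc w) with h | h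
    · exact Or.inl ⟨w, hw h, rfl⟩
    · exact Or.inr ⟨w, h, rfl⟩
  · filter_upwards [h] with w hw using Or.inl ⟨w, hw, rfl⟩

theorem not_isBounded_of_rot {k : ℂ → ℂ} (hk : k = rot ∨ k = rot ∘ rot) {x : ℂ}
    (hx : x ∈ attractor) (hK : x ∉ curve) :
    ¬ Bornology.IsBounded (connectedComponentIn attractorᶜ (k x)) := by
  have hkc : Continuous k := by rcases hk with rfl | rfl <;> fun_prop
  obtain ⟨y, hy0, hy⟩ := joinedIn_of_cell (cell_of_mem_attractor hx hK) hK
  have hj : JoinedIn attractorᶜ (k x) (k y) := by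
    refine (hy.map hkc).mono ?_
    rintro _ ⟨z, hz, rfl⟩
    exact rot_notMem_attractor hk hz.1 hz.2
  have hmem : k y ∈ connectedComponentIn attractorᶜ (k x) := by
    obtain ⟨γ, hγ⟩ := hj
    have hc : IsPreconnected (Set.range γ) := isPreconnected_range γ.continuous
    exact hc.subset_connectedComponentIn ⟨0, γ.source⟩ (by rintro _ ⟨t, rfl⟩; exact hγ t)
      ⟨1, γ.target⟩
  have hopen : IsOpen (connectedComponentIn attractorᶜ (k x)) :=
    isClosed_attractor.isOpen_compl.connectedComponentIn
  -- The point `k y` lies on a side of `equi`; moving `y` below the base takes its image out of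
  -- `equi` while staying in the same open component.
  have ht : Tendsto (fun t : ℝ => k (y - t * omega)) (𝓝[>] 0) (𝓝 (k y)) := by
    have hc : Continuous fun t : ℝ => k (y - t * omega) := hkc.comp (by fun_prop)
    have := hc.tendsto 0
    simp only [Complex.ofReal_zero, zero_mul, sub_zero] at this
    exact this.mono_left nhdsWithin_le_nhds
  obtain ⟨t, htm, ht0⟩ := ((ht.eventually (hopen.mem_nhds hmem)).and
    self_mem_nhdsWithin).exists
  have ht0 : 0 < t := ht0
  rw [connectedComponentIn_eq htm]
  apply not_isBounded_of_notMem_equi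
  intro hm
  rcases hk with rfl | rfl
  · have := hm.2.2
    simp [hy0] at this
    linarith
  · have := hm.1
    simp [hy0] at this
    linarith

theorem not_isBounded_connectedComponentIn {z : ℂ} (hz : z ∉ attractor) :
    ¬ Bornology.IsBounded (connectedComponentIn attractorᶜ z) := by
  have hopen : IsOpen (connectedComponentIn attractorᶜ z) :=
    isClosed_attractor.isOpen_compl.connectedComponentIn
  have hnull : volume (rot '' curve ∪ (rot ∘ rot) '' curve) = 0 := by
    have h1 : volume.real (rot '' curve) = 0 := by
      rw [volume_real_image_rot, measureReal_def, volume_curve, ENNReal.toReal_zero]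
    have h2 : volume.real ((rot ∘ rot) '' curve) = 0 := by
      rw [Set.image_comp, volume_real_image_rot, h1]
    rw [measure_union_null_iff]
    refine ⟨(measureReal_eq_zero_iff (isCompact_curve.image continuous_rot).measure_ne_top).1 h1,
      (measureReal_eq_zero_iff (isCompact_curve.image
        (continuous_rot.comp continuous_rot)).measure_ne_top).1 h2⟩
  -- The component is open and the rotated curves are null, so its base point can be changed to one
  -- avoiding them.
  obtain ⟨w, hwO, hwK⟩ : ∃ w ∈ connectedComponentIn attractorᶜ z,
      w ∉ rot '' curve ∪ (rot ∘ rot) '' curve := by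
    by_contra! hcon
    exact (hopen.measure_pos volume ⟨z, mem_connectedComponentIn hz⟩).ne'
      (measure_mono_null hcon hnull)
  rw [connectedComponentIn_eq hwO]
  by_cases hwe : w ∈ equi
  swap
  · exact not_isBounded_of_notMem_equi hwe
  rw [Set.mem_union, not_or] at hwK
  rcases equi_subset_tiles hwe with h | h | h
  · exact absurd h (connectedComponentIn_subset _ _ hwO)
  · have e : (rot ∘ rot) (rot w) = w := rot_rot_rot w
    rw [← e]
    exact not_isBounded_of_rot (Or.inr rfl) h fun hK => hwK.2 ⟨_, hK, e⟩
  · have e : rot (rot (rot w)) = w := rot_rot_rot w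
    rw [← e]
    exact not_isBounded_of_rot (Or.inl rfl) h fun hK => hwK.1 ⟨_, hK, e⟩

theorem region_eq_attractor : region = attractor := by
  refine Set.Subset.antisymm ?_ attractor_subset_region
  have hX : curve ∪ segment ℝ (0 : ℂ) 1 ⊆ attractor :=
    Set.union_subset curve_subset_attractor segment_subset_attractor
  rintro z (hz | ⟨-, hz⟩)
  · exact hX hz
  · by_contra hza
    exact not_isBounded_connectedComponentIn hza
      (hz.subset (connectedComponentIn_mono z (Set.compl_subset_compl.2 hX)))

/-! ### Volumes of solids of revolution -/

theorem lintegral_radial {F : ℝ → ENNReal} (hF : Measurable F) :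
    ∫⁻ q : ℝ × ℝ, F √(q.1 ^ 2 + q.2 ^ 2) =
      ENNReal.ofReal (2 * Real.pi) * ∫⁻ r, ENNReal.ofReal r * F r := by
  have hm : Measurable fun r : ℝ => ENNReal.ofReal r * F r := by fun_prop
  rw [← lintegral_comp_polarCoord_symm]
  have e : ∀ p ∈ polarCoord.target, ENNReal.ofReal p.1 •
      F √((polarCoord.symm p).1 ^ 2 + (polarCoord.symm p).2 ^ 2) = ENNReal.ofReal p.1 * F p.1 := by
    rintro ⟨r, θ⟩ hp
    have hr : 0 < r := hp.1
    have : √((r * Real.cos θ) ^ 2 + (r * Real.sin θ) ^ 2) = r := by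
      rw [mul_pow, mul_pow, ← mul_add, Real.cos_sq_add_sin_sq, mul_one, Real.sqrt_sq hr.le]
    simp only [polarCoord_symm_apply, this, smul_eq_mul]
  rw [setLIntegral_congr_fun polarCoord.open_target.measurableSet e]
  change ∫⁻ p in Set.Ioi (0 : ℝ) ×ˢ Set.Ioo (-Real.pi) Real.pi, _ = _
  rw [Measure.volume_eq_prod, ← Measure.prod_restrict,
    lintegral_prod _ (by fun_prop)]
  simp only [lintegral_const, Measure.restrict_apply_univ, Real.volume_Ioo]
  rw [lintegral_mul_const _ hm, mul_comm]
  congr 1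
  · congr 1; ring
  · rw [← lintegral_indicator measurableSet_Ioi]
    congr 1
    ext r
    by_cases hr : 0 < r
    · rw [Set.indicator_of_mem (Set.mem_Ioi.2 hr)]
    -- The weight `ENNReal.ofReal r` vanishes for `r ≤ 0`, so the radial integral may run over all
    -- of `ℝ`.
    · rw [Set.indicator_of_notMem (show r ∉ Set.Ioi 0 from hr), ENNReal.ofReal_of_nonpos (not_lt.1 hr), zero_mul]

/-- The point of the closed upper half plane from which a point in space is obtained by a
revolution about the first axis. -/
def profile (q : ℝ × (ℝ × ℝ)) : ℂ := ⟨q.1, √(q.2.1 ^ 2 + q.2.2 ^ 2)⟩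

theorem measurable_profile : Measurable profile :=
  Complex.measurableEquivRealProd.symm.measurable.comp
    (f := fun q : ℝ × (ℝ × ℝ) => (q.1, √(q.2.1 ^ 2 + q.2.2 ^ 2))) (by fun_prop)

/-- The splitting of space into the first axis and a plane. -/
def splitSpace (p : EuclideanSpace ℝ (Fin 3)) : ℝ × (ℝ × ℝ) := (p 0, (p 1, p 2))

theorem measurePreserving_splitSpace : MeasurePreserving splitSpace :=
  (((MeasurePreserving.id (volume : Measure ℝ)).prod (volume_preserving_finTwoArrow ℝ)).comp
    (volume_preserving_piFinSuccAbove (fun _ : Fin 3 => ℝ) 0)).comp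
      (PiLp.volume_preserving_ofLp (Fin 3))

theorem revolve_eq_preimage {S : Set ℂ} (hS : ∀ z ∈ S, 0 ≤ z.im) :
    revolve S = splitSpace ⁻¹' (profile ⁻¹' S) := by
  ext p
  constructor
  · rintro ⟨z, hz, θ, rfl⟩
    have : profile (splitSpace !₂[z.re, z.im * Real.cos θ, z.im * Real.sin θ]) = z := by
      apply Complex.ext
      · rfl
      · change √((z.im * Real.cos θ) ^ 2 + (z.im * Real.sin θ) ^ 2) = z.im
        rw [mul_pow, mul_pow, ← mul_add, Real.cos_sq_add_sin_sq, mul_one, Real.sqrt_sq (hS z hz)]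
    rw [Set.mem_preimage, Set.mem_preimage, this]
    exact hz
  · intro hp
    let w : ℂ := ⟨p 1, p 2⟩
    have hw : ‖w‖ = √(p 1 ^ 2 + p 2 ^ 2) := by
      rw [Complex.norm_def, Complex.normSq_apply, sq, sq]
    refine ⟨_, hp, w.arg, ?_⟩
    ext i
    fin_cases i
    · rfl
    · change p 1 = √(p 1 ^ 2 + p 2 ^ 2) * Real.cos w.arg
      rw [← hw, Complex.norm_mul_cos_arg]
    · change p 2 = √(p 1 ^ 2 + p 2 ^ 2) * Real.sin w.arg
      rw [← hw, Complex.norm_mul_sin_arg]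

/-- Pappus' theorem: each slice orthogonal to the axis is rotation invariant, so polar coordinates
give its area as the integral of `2πr` over the corresponding slice of `S`; Tonelli reassembles the
slices. -/
theorem volume_revolve {S : Set ℂ} (hS : IsCompact S) (hpos : ∀ z ∈ S, 0 ≤ z.im) :
    volume (revolve S) = ENNReal.ofReal (2 * Real.pi * ∫ z in S, z.im) := by
  have hSm := hS.measurableSet
  have hP := measurable_profile hSm
  have hF : ∀ x : ℝ, Measurable fun r : ℝ => S.indicator (fun _ => (1 : ENNReal)) (⟨x, r⟩ : ℂ) :=
    fun x => (measurable_const.indicator hSm).comp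
      (Complex.measurableEquivRealProd.symm.measurable.comp (by fun_prop :
        Measurable fun r : ℝ => (x, r)))
  have hG : Measurable (S.indicator fun z : ℂ => ENNReal.ofReal z.im) :=
    Measurable.indicator (by fun_prop) hSm
  rw [revolve_eq_preimage hpos, measurePreserving_splitSpace.measure_preimage
    hP.nullMeasurableSet, ← lintegral_indicator_one hP, Measure.volume_eq_prod,
    lintegral_prod _ (measurable_one.indicator hP).aemeasurable]
  have e : ∀ x : ℝ, ∫⁻ y : ℝ × ℝ, (profile ⁻¹' S).indicator 1 (x, y) =
      ENNReal.ofReal (2 * Real.pi) * ∫⁻ r, S.indicator (fun z : ℂ => ENNReal.ofReal z.im)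
        ⟨x, r⟩ := by
    intro x
    refine (lintegral_radial (hF x)).trans ?_
    congr 2
    ext r
    by_cases hr : (⟨x, r⟩ : ℂ) ∈ S
    · simp [hr]
    · simp [hr]
  simp only [e]
  have mp := Complex.volume_preserving_equiv_real_prod.symm
  have hG' : Measurable fun p : ℝ × ℝ =>
      S.indicator (fun z : ℂ => ENNReal.ofReal z.im) ⟨p.1, p.2⟩ := hG.comp mp.measurable
  rw [lintegral_const_mul' _ _ ENNReal.ofReal_ne_top,
    ← lintegral_prod (fun p : ℝ × ℝ => S.indicator (fun z : ℂ => ENNReal.ofReal z.im) ⟨p.1, p.2⟩)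
      hG'.aemeasurable, ← Measure.volume_eq_prod]
  have h2 := mp.lintegral_comp hG
  rw [show ∫⁻ p : ℝ × ℝ, S.indicator (fun z : ℂ => ENNReal.ofReal z.im) ⟨p.1, p.2⟩ = _ from h2,
    lintegral_indicator hSm, ENNReal.ofReal_mul (p := 2 * Real.pi) (by positivity)]
  congr 1
  rw [ofReal_integral_eq_lintegral_ofReal]
  · exact Complex.continuous_im.continuousOn.integrableOn_compact hS
  · exact (ae_restrict_iff' hSm).2 (Eventually.of_forall hpos)

theorem im_centroid_mul_area_region :
    (centroid region).im * area region = 17 / 888 := by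
  rw [region_eq_attractor, centroid, area, setAverage_eq, volume_real_attractor, Complex.smul_im,
    integral_attractor_im, smul_eq_mul, mul_comm, mul_inv_cancel_left₀ (by positivity)]

end Kochawave

end

theorem mainTheorem4 :
    MeasureTheory.volume (Kochawave.revolve Kochawave.region) =
        ENNReal.ofReal (2 * Real.pi * (Kochawave.centroid Kochawave.region).im *
          Kochawave.area Kochawave.region) ∧
      2 * Real.pi * (Kochawave.centroid Kochawave.region).im *
          Kochawave.area Kochawave.region = 17 * Real.pi / 444 := by
  have hpos : ∀ z ∈ Kochawave.attractor, 0 ≤ z.im := fun z hz => by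
    rw [Kochawave.im_eq]
    exact mul_nonneg (by positivity) (Kochawave.attractor_subset_equi hz).2.1
  have him : ∫ z in Kochawave.attractor, z.im = 17 / 888 := by
    rw [← Kochawave.integral_attractor_im]
    exact integral_im
      (continuous_id.continuousOn.integrableOn_compact Kochawave.isCompact_attractor)
  constructor
  · rw [mul_assoc, Kochawave.im_centroid_mul_area_region, Kochawave.region_eq_attractor,
      Kochawave.volume_revolve Kochawave.isCompact_attractor hpos, him]
  · rw [mul_assoc, Kochawave.im_centroid_mul_area_region]
    ring
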